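/- Let $\mathcal R=\{(x,\lambda): 0\le x<1,\ \max\{0,(2x-1)/x\}\le\lambda\le 1\}$ (for $x=0$: $0\le\lambda\le1$). For $(x,\lambda)\in\mathcal R$ the test outcomes $T_1,T_2,\dots\in\{0,1\}$ (1 = failure) form the Klotz Markov chain: $P(T_1=1)=x$, $P(T_{i+1}=1\mid T_i=1)=\lambda$, $P(T_{i+1}=1\mid T_i=0)=\frac{(1-\lambda)x}{1-x}$. For $n\ge1$ the probability of $n$ demands without failure is $$L(x,\lambda;n)=(1-x)\Bigl(1-\tfrac{(1-\lambda)x}{1-x}\Bigr)^{n-1},\qquad L(1,\cdot;n):=0 .$$ For a prior, i.e. a probability distribution of $(X,\Lambda)$ on $\mathcal R$, the posterior confidence in a bound $b$ is $$P(X\le b\mid n\text{ demands without failure})=\frac{E[L(X,\Lambda;n)\mathbf 1_{X\in[0,b]}]}{E[L(X,\Lambda;n)]}.$$ Let $n\ge1$, $0<b<\tfrac12$, let $f\ge0$ be a probability density on $[0,1]$, and let $\varphi_1,\varphi_2\ge0$ satisfy $\varphi_1\le\int_0^bf\le1-\varphi_2$, with $\int_0^bf>0$. Let $\mathcal D$ be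 the set of priors such that (PK1) $P(X\le u)=\int_0^uf(x)\,dx$ for all $u\in[0,1]$; (PK2) $P(\Lambda<X)=\varphi_1$; (PK3) $P(\Lambda>X)=\varphi_2$; (PK4) $\varphi_1\le P(X\le b)\le1-\varphi_2$. Put $$g_l(x)=(L(x,x;n)-L(x,0;n))\mathbf 1_{x\in[0,1/2]},\qquad g_u(x)=(L(x,1;n)-L(x,x;n))\mathbf 1_{x\in[0,1]} .$$ (i) $g_l$ maps $[0,\tfrac12]$ into $[0,1]$ and $g_u$ maps $[0,1]$ into $[0,1]$. (ii) The following two minimisation problems have solutions $(r,s)=(c_*^1,c_*^2)$ and $(v,w)=(c_1^*,c_2^*)$ respectively: minimise $|g_l(r)-g_l(s)|$ over $0\le r<s\le b$ with $g_l(0)\le g_l(r)$, $g_l(b)\le g_l(s)$ and $\int_r^sf=\varphi_1$; minimise $|g_u(v)-g_u(w)|$ over $b\le v<w\le1$ with $g_u(b)\le g_u(v)$, $g_u(1)\le g_u(w)$ and $\int_v^wf=\varphi_2$. (If $\varphi_1=0$, resp. $\varphi_2=0$, then $r=s$, resp. $v=w$, is also admitted.) (iii) If $n\ge2$ and $\int_u^vf>0$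 whenever $0\le u<v\le1$, then the solution $(c_*^1,c_*^2)$ is unique when $\varphi_1>0$, and the solution $(c_1^*,c_2^*)$ is unique when $\varphi_2>0$. (iv) For any such solutions, $\inf_{\mathcal D}P(X\le b\mid n\text{ demands without failure})=\frac1{1+Q}$, where $$Q=\frac{\int_b^1\bigl((1-x)^n\mathbf 1_{x\in(b,c_1^*)\cup(c_2^*,1)}+(1-x)\mathbf 1_{x\in(c_1^*,c_2^*)}\bigr)f(x)\,dx}{\int_0^b\bigl((1-x)^n\mathbf 1_{x\in(0,c_*^1)\cup(c_*^2,b)}+\frac{(1-2x)^{n-1}}{(1-x)^{n-2}}\mathbf 1_{x\in(c_*^1,c_*^2)}\bigr)f(x)\,dx}$$ has a positive denominator. The infimum is attained by the following prior in $\mathcal D$: the law of $(X,\Lambda)$, where $X$ has density $f$ and $\Lambda=0$ if $X\in(c_*^1,c_*^2)$, $\Lambda=1$ if $X\in(c_1^*,c_2^*)$, and $\Lambda=X$ otherwise. It gives mass $\varphi_1$ to $(c_*^1,c_*^2)\times\{0\}$ and mass $\varphi_2$ to $(c_1^*,c_2^*)\times\{1\}$. -/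

import Mathlib

open MeasureTheory Set

noncomputable section

namespace Klotz

/-! ### The Klotz chain.  Outcome `true` is a failure, `false` a success. -/

/-- Law of the first outcome: a failure has probability `x`. -/
def initProb (x : ℝ) : Bool → ℝ
  | true => x
  | false => 1 - x

/-- One-step transition probabilities, from the first outcome to the second one. -/
def stepProb (x lam : ℝ) : Bool → Bool → ℝ
  | true, true => lam
  | true, false => 1 - lam
  | false, true => (1 - lam) * x / (1 - x)
  | false, false => 1 - (1 - lam) * x / (1 - x)

/-- Probability that the chain, now at a given outcome, continues with a given list of outcomes. -/
def contProb (x lam : ℝ) : Bool → List Bool → ℝ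
  | _, [] => 1
  | s, t :: ts => stepProb x lam s t * contProb x lam t ts

/-- Probability of a finite sequence of outcomes. -/
def pathProb (x lam : ℝ) : List Bool → ℝ
  | [] => 1
  | t :: ts => initProb x t * contProb x lam t ts

/-- The likelihood `L(x, λ; n)`: the probability that the first `n` demands are failure-free. -/
def likelihood (x lam : ℝ) (n : ℕ) : ℝ :=
  pathProb x lam (List.replicate n false)

/-- First-order stationarity of the chain. -/
theorem stationary (x lam : ℝ) (hx : x ≠ 1) (t : Bool) :
    initProb x true * stepProb x lam true t + initProb x false * stepProb x lam false t
      = initProb x t := by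
  have h : (1 : ℝ) - x ≠ 0 := sub_ne_zero.mpr (Ne.symm hx)
  cases t <;> simp only [initProb, stepProb] <;> field_simp <;> ring

theorem contProb_replicate (x lam : ℝ) (m : ℕ) :
    contProb x lam false (List.replicate m false) = (1 - (1 - lam) * x / (1 - x)) ^ m := by
  induction m with
  | zero => simp [contProb]
  | succ m ih => rw [List.replicate_succ, contProb, ih, stepProb, pow_succ, mul_comm]

/-- Closed form of the likelihood; at `x = 1` the value is `0`. -/
theorem likelihood_eq (x lam : ℝ) (n : ℕ) (hn : 1 ≤ n) :
    likelihood x lam n = (1 - x) * (1 - (1 - lam) * x / (1 - x)) ^ (n - 1) := by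
  obtain ⟨m, rfl⟩ : ∃ m, n = m + 1 := ⟨n - 1, by omega⟩
  rw [likelihood, List.replicate_succ, pathProb, contProb_replicate, initProb,
    Nat.add_sub_cancel]

/-! ### Priors -/

/-- The region of admissible parameters `(x, λ)`. -/
def region : Set (ℝ × ℝ) :=
  {p | 0 ≤ p.1 ∧ p.1 < 1 ∧ max 0 ((2 * p.1 - 1) / p.1) ≤ p.2 ∧ p.2 ≤ 1}

/-- Prior distributions of `(X, Λ)`: probability measures concentrated on the region. -/
def IsPrior (F : Measure (ℝ × ℝ)) : Prop :=
  IsProbabilityMeasure F ∧ F regionᶜ = 0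

/-- `X` has density `f`. -/
def PK1 (f : ℝ → ℝ) (F : Measure (ℝ × ℝ)) : Prop :=
  ∀ u ∈ Icc (0 : ℝ) 1, F.real {p | p.1 ≤ u} = ∫ x in (0 : ℝ)..u, f x

/-- Confidence `φ₁` in negative correlation. -/
def PK2 (φ₁ : ℝ) (F : Measure (ℝ × ℝ)) : Prop :=
  F.real {p | p.2 < p.1} = φ₁

/-- Confidence `φ₂` in positive correlation. -/
def PK3 (φ₂ : ℝ) (F : Measure (ℝ × ℝ)) : Prop :=
  F.real {p | p.1 < p.2} = φ₂

/-- Confidence in the bound `b`. -/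
def PK4 (b φ₁ φ₂ : ℝ) (F : Measure (ℝ × ℝ)) : Prop :=
  φ₁ ≤ F.real {p | p.1 ≤ b} ∧ F.real {p | p.1 ≤ b} ≤ 1 - φ₂

/-- The priors over which the posterior confidence is minimised. -/
def feasiblePriors (f : ℝ → ℝ) (b φ₁ φ₂ : ℝ) : Set (Measure (ℝ × ℝ)) :=
  {F | IsPrior F ∧ PK1 f F ∧ PK2 φ₁ F ∧ PK3 φ₂ F ∧ PK4 b φ₁ φ₂ F}

/-- Posterior confidence `P(X ≤ b ∣ n demands without failure)` under the prior `F`. -/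
def posteriorConfidence (b : ℝ) (n : ℕ) (F : Measure (ℝ × ℝ)) : ℝ :=
  (∫ p in {p : ℝ × ℝ | p.1 ∈ Icc 0 b}, likelihood p.1 p.2 n ∂F) /
    ∫ p, likelihood p.1 p.2 n ∂F

/-! ### The cut-points -/

def gl (n : ℕ) (x : ℝ) : ℝ :=
  (Icc (0 : ℝ) (1 / 2)).indicator (fun x => likelihood x x n - likelihood x 0 n) x

def gu (n : ℕ) (x : ℝ) : ℝ :=
  (Icc (0 : ℝ) 1).indicator (fun x => likelihood x 1 n - likelihood x x n) x

/-- Admissible `(r, s)`.  The inequality `r < s` is relaxed to `r ≤ s` only if `φ₁ = 0`. -/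
def lowerConstraint (f : ℝ → ℝ) (b φ₁ : ℝ) (n : ℕ) : Set (ℝ × ℝ) :=
  {p | 0 ≤ p.1 ∧ p.1 ≤ p.2 ∧ (0 < φ₁ → p.1 < p.2) ∧ p.2 ≤ b ∧
    gl n 0 ≤ gl n p.1 ∧ gl n b ≤ gl n p.2 ∧ ∫ x in p.1..p.2, f x = φ₁}

/-- Admissible `(v, w)`.  The inequality `v < w` is relaxed to `v ≤ w` only if `φ₂ = 0`. -/
def upperConstraint (f : ℝ → ℝ) (b φ₂ : ℝ) (n : ℕ) : Set (ℝ × ℝ) :=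
  {p | b ≤ p.1 ∧ p.1 ≤ p.2 ∧ (0 < φ₂ → p.1 < p.2) ∧ p.2 ≤ 1 ∧
    gu n b ≤ gu n p.1 ∧ gu n 1 ≤ gu n p.2 ∧ ∫ x in p.1..p.2, f x = φ₂}

/-- `p` is a minimiser of `|g_l(r) - g_l(s)|` over the admissible `(r, s)`. -/
def IsLowerCut (f : ℝ → ℝ) (b φ₁ : ℝ) (n : ℕ) (p : ℝ × ℝ) : Prop :=
  p ∈ lowerConstraint f b φ₁ n ∧
    IsMinOn (fun q : ℝ × ℝ => |gl n q.1 - gl n q.2|) (lowerConstraint f b φ₁ n) p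

/-- `p` is a minimiser of `|g_u(v) - g_u(w)|` over the admissible `(v, w)`. -/
def IsUpperCut (f : ℝ → ℝ) (b φ₂ : ℝ) (n : ℕ) (p : ℝ × ℝ) : Prop :=
  p ∈ upperConstraint f b φ₂ n ∧
    IsMinOn (fun q : ℝ × ℝ => |gu n q.1 - gu n q.2|) (upperConstraint f b φ₂ n) p

/-! ### The extreme prior and the ratio `Q` -/

/-- The value of `λ` that the extreme prior attaches to `x`; here `c` is the lower and `d` the
upper pair of cut-points. -/
def extremeLam (c d : ℝ × ℝ) (x : ℝ) : ℝ :=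
  open Classical in
  if x ∈ Ioo c.1 c.2 then 0 else if x ∈ Ioo d.1 d.2 then 1 else x

/-- The law of `(X, extremeLam X)`, where `X` has density `f` on `[0, 1]`. -/
def extremePrior (f : ℝ → ℝ) (c d : ℝ × ℝ) : Measure (ℝ × ℝ) :=
  ((volume.restrict (Icc (0 : ℝ) 1)).withDensity (fun x => ENNReal.ofReal (f x))).map
    (fun x => (x, extremeLam c d x))

/-- Numerator of `Q`. -/
def Qnum (f : ℝ → ℝ) (b : ℝ) (n : ℕ) (d : ℝ × ℝ) : ℝ :=
  ∫ x in b..1,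
    ((1 - x) ^ n * (Ioo b d.1 ∪ Ioo d.2 1).indicator 1 x
      + (1 - x) * (Ioo d.1 d.2).indicator 1 x) * f x

/-- Denominator of `Q`. -/
def Qden (f : ℝ → ℝ) (b : ℝ) (n : ℕ) (c : ℝ × ℝ) : ℝ :=
  ∫ x in (0 : ℝ)..b,
    ((1 - x) ^ n * (Ioo 0 c.1 ∪ Ioo c.2 b).indicator 1 x
      + (1 - 2 * x) ^ (n - 1) / (1 - x) ^ ((n : ℤ) - 2) * (Ioo c.1 c.2).indicator 1 x) * f x

def Q (f : ℝ → ℝ) (b : ℝ) (n : ℕ) (c d : ℝ × ℝ) : ℝ :=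
  Qnum f b n d / Qden f b n c

end Klotz

end

namespace Klotz

/-! ### Strict quasi-concavity -/

/-- Between two points of `[a, b]`, `g` is above the smaller of the two values. -/
def StrictQuasiconcave (g : ℝ → ℝ) (a b : ℝ) : Prop :=
  ∀ x y z, a ≤ x → x < y → y < z → z ≤ b → min (g x) (g z) < g y

theorem strictQuasiconcave_of_hasDerivAt {g g' : ℝ → ℝ} {a b : ℝ}
    (hg : ∀ x ∈ Icc a b, HasDerivAt g (g' x) x)
    (hsign : ∀ x y, a < x → x < y → y ≤ b → 0 ≤ g' y → 0 < g' x) :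
    StrictQuasiconcave g a b := by
  intro x y z hax hxy hyz hzb
  by_contra! h
  have hcont : ContinuousOn g (Icc a b) := fun u hu => (hg u hu).continuousAt.continuousWithinAt
  obtain ⟨ξ, hξ, hξ'⟩ := exists_hasDerivAt_eq_slope g g' hxy
    (hcont.mono (Icc_subset_Icc hax (by linarith)))
    (fun u hu => hg u ⟨by linarith [hu.1], by linarith [hu.2]⟩)
  obtain ⟨η, hη, hη'⟩ := exists_hasDerivAt_eq_slope g g' hyz
    (hcont.mono (Icc_subset_Icc (by linarith) hzb))
    (fun u hu => hg u ⟨by linarith [hu.1], by linarith [hu.2]⟩)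
  have h1 : g' ξ ≤ 0 := by
    rw [hξ']
    exact div_nonpos_of_nonpos_of_nonneg (by linarith [h.trans (min_le_left _ _)]) (by linarith)
  have h2 : 0 ≤ g' η := by
    rw [hη']
    exact div_nonneg (by linarith [h.trans (min_le_right _ _)]) (by linarith)
  have := hsign ξ η (hax.trans_lt hξ.1) (hξ.2.trans hη.1) (by linarith [hη.2]) h2
  linarith

/-! ### The likelihood on the edges of the region -/

theorem likelihood_self (x : ℝ) {n : ℕ} (hn : 1 ≤ n) : likelihood x x n = (1 - x) ^ n := by
  rw [likelihood_eq x x n hn]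
  rcases eq_or_ne x 1 with rfl | hx
  · have : n ≠ 0 := by omega
    simp [this]
  · have h : 1 - x ≠ 0 := sub_ne_zero.mpr hx.symm
    rw [mul_div_assoc, mul_div_cancel₀ x h, ← pow_succ']
    congr 1
    omega

theorem likelihood_one (x : ℝ) {n : ℕ} (hn : 1 ≤ n) : likelihood x 1 n = 1 - x := by
  simp [likelihood_eq x 1 n hn]

theorem likelihood_zero {x : ℝ} (hx : x < 1) {n : ℕ} (hn : 1 ≤ n) :
    likelihood x 0 n = (1 - 2 * x) ^ (n - 1) / (1 - x) ^ ((n : ℤ) - 2) := by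
  obtain ⟨m, rfl⟩ : ∃ m, n = m + 1 := ⟨n - 1, by omega⟩
  have h : 1 - x ≠ 0 := by linarith
  have e : ((m + 1 : ℕ) : ℤ) - 2 = (m : ℤ) - 1 := by push_cast; ring
  have e' : 1 - (1 - 0) * x / (1 - x) = (1 - 2 * x) / (1 - x) := by field_simp; ring
  rw [likelihood_eq x 0 _ hn, e', e, zpow_sub_one₀ h, zpow_natCast, Nat.add_sub_cancel, div_pow]
  field_simp

/-- On the region the success probability after a success is nonnegative. -/
theorem stepProb_false_nonneg {x lam : ℝ} (h : (x, lam) ∈ region) :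
    0 ≤ 1 - (1 - lam) * x / (1 - x) := by
  obtain ⟨h0, h1, h2, -⟩ := h
  simp only at h0 h1 h2
  rw [sub_nonneg, div_le_one (by linarith)]
  rcases h0.eq_or_lt with rfl | h0
  · simp
  · have h3 := (le_max_right _ _).trans h2
    rw [div_le_iff₀ h0] at h3
    linarith

theorem likelihood_le_of_le {x lam lam' : ℝ} {n : ℕ} (hn : 1 ≤ n) (h : (x, lam) ∈ region)
    (hl : lam ≤ lam') : likelihood x lam n ≤ likelihood x lam' n := by
  rw [likelihood_eq _ _ n hn, likelihood_eq _ _ n hn]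
  have hb := stepProb_false_nonneg h
  obtain ⟨h0, h1, -, -⟩ := h
  simp only at h0 h1
  have h2 : 0 < 1 - x := by linarith
  have : (1 - lam') * x / (1 - x) ≤ (1 - lam) * x / (1 - x) := by gcongr
  gcongr

theorem likelihood_nonneg {x lam : ℝ} {n : ℕ} (hn : 1 ≤ n) (h : (x, lam) ∈ region) :
    0 ≤ likelihood x lam n := by
  rw [likelihood_eq _ _ n hn]
  have hb := stepProb_false_nonneg h
  have h1 : 0 < 1 - x := by linarith [h.2.1]
  positivity

theorem likelihood_le_one {x lam : ℝ} {n : ℕ} (hn : 1 ≤ n) (h : (x, lam) ∈ region) :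
    likelihood x lam n ≤ 1 := by
  refine (likelihood_le_of_le hn h h.2.2.2).trans ?_
  rw [likelihood_one _ hn]
  linarith [h.1]

theorem self_mem_region {x : ℝ} (h0 : 0 ≤ x) (h1 : x < 1) : (x, x) ∈ region := by
  refine ⟨h0, h1, max_le h0 ?_, h1.le⟩
  rcases h0.eq_or_lt with rfl | h
  · simp
  · simp only
    rw [div_le_iff₀ h]
    nlinarith [sq_nonneg (x - 1)]

theorem one_mem_region {x : ℝ} (h0 : 0 ≤ x) (h1 : x < 1) : (x, 1) ∈ region := by
  refine ⟨h0, h1, max_le zero_le_one ?_, le_rfl⟩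
  exact (self_mem_region h0 h1).2.2.1.trans' (le_max_right _ _) |>.trans h1.le

theorem zero_mem_region {x : ℝ} (h0 : 0 ≤ x) (h1 : x ≤ 1 / 2) : (x, 0) ∈ region :=
  ⟨h0, by simp only; linarith, max_le le_rfl
    (div_nonpos_of_nonpos_of_nonneg (by simp only; linarith) h0), zero_le_one⟩

/-! ### The functions `gl` and `gu` -/

theorem gl_eq {n : ℕ} {x : ℝ} (hx : x ∈ Icc (0 : ℝ) (1 / 2)) :
    gl n x = likelihood x x n - likelihood x 0 n := indicator_of_mem hx _

theorem gu_eq {n : ℕ} {x : ℝ} (hx : x ∈ Icc (0 : ℝ) 1) :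
    gu n x = likelihood x 1 n - likelihood x x n := indicator_of_mem hx _

theorem gu_eq_sub_pow {n : ℕ} (hn : 1 ≤ n) {x : ℝ} (hx : x ∈ Icc (0 : ℝ) 1) :
    gu n x = (1 - x) - (1 - x) ^ n := by
  rw [gu_eq hx, likelihood_one x hn, likelihood_self x hn]

theorem gl_mapsTo {n : ℕ} (hn : 1 ≤ n) : MapsTo (gl n) (Icc 0 (1 / 2)) (Icc 0 1) := by
  intro x hx
  have h1 : x < 1 := by linarith [hx.2]
  have hz := zero_mem_region hx.1 hx.2
  have hs := self_mem_region hx.1 h1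
  rw [gl_eq hx]
  constructor
  · linarith [likelihood_le_of_le hn hz hx.1]
  · linarith [likelihood_le_one hn hs, likelihood_nonneg hn hz]

theorem gu_mapsTo {n : ℕ} (hn : 1 ≤ n) : MapsTo (gu n) (Icc 0 1) (Icc 0 1) := by
  intro x hx
  rw [gu_eq_sub_pow hn hx]
  have h0 : 0 ≤ 1 - x := by linarith [hx.2]
  have := pow_le_of_le_one h0 (by linarith [hx.1]) (by omega : n ≠ 0)
  constructor
  · linarith
  · linarith [pow_nonneg h0 n, hx.1]

theorem gl_zero (n : ℕ) : gl n 0 = 0 := by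
  rw [gl_eq ⟨le_rfl, by norm_num⟩, sub_self]

theorem gu_apply_one {n : ℕ} (hn : 1 ≤ n) : gu n 1 = 0 := by
  have : n ≠ 0 := by omega
  rw [gu_eq_sub_pow hn ⟨zero_le_one, le_rfl⟩]
  simp [this]

theorem measurable_likelihood {n : ℕ} (hn : 1 ≤ n) :
    Measurable fun p : ℝ × ℝ => likelihood p.1 p.2 n := by
  simp_rw [likelihood_eq _ _ n hn]
  fun_prop

theorem measurable_gl {n : ℕ} (hn : 1 ≤ n) : Measurable (gl n) := by
  have h := measurable_likelihood hn
  refine Measurable.indicator ?_ measurableSet_Icc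
  exact (h.comp (measurable_id.prodMk measurable_id)).sub
    (h.comp (measurable_id.prodMk measurable_const))

theorem measurable_gu {n : ℕ} (hn : 1 ≤ n) : Measurable (gu n) := by
  have h := measurable_likelihood hn
  refine Measurable.indicator ?_ measurableSet_Icc
  exact (h.comp (measurable_id.prodMk measurable_const)).sub
    (h.comp (measurable_id.prodMk measurable_id))

theorem continuousOn_gl {n : ℕ} (hn : 1 ≤ n) : ContinuousOn (gl n) (Icc 0 (1 / 2)) := by
  have : ContinuousOn (fun x : ℝ => (1 - x) ^ n - (1 - x) * (1 - (1 - 0) * x / (1 - x)) ^ (n - 1))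
      (Icc 0 (1 / 2)) := by
    have h : ∀ x ∈ Icc (0 : ℝ) (1 / 2), 1 - x ≠ 0 := fun x hx => by linarith [hx.2]
    fun_prop (disch := assumption)
  refine this.congr fun x hx => ?_
  rw [gl_eq hx, likelihood_self x hn, likelihood_eq x 0 n hn]

theorem continuousOn_gu {n : ℕ} (hn : 1 ≤ n) : ContinuousOn (gu n) (Icc 0 1) := by
  have : ContinuousOn (fun x : ℝ => (1 - x) - (1 - x) ^ n) (Icc 0 1) := by fun_prop
  exact this.congr fun x hx => gu_eq_sub_pow hn hx

theorem strictQuasiconcave_gu {n : ℕ} (hn : 2 ≤ n) : StrictQuasiconcave (gu n) 0 1 := by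
  intro x y z hx hxy hyz hz
  have hn1 : 1 ≤ n := by omega
  rw [gu_eq_sub_pow hn1 ⟨hx, by linarith⟩, gu_eq_sub_pow hn1 ⟨by linarith, hz⟩,
    gu_eq_sub_pow hn1 ⟨by linarith, by linarith⟩]
  have hd : 0 < z - x := by linarith
  have h := (strictConvexOn_pow hn).2 (show 1 - x ∈ Ici (0 : ℝ) by simp only [mem_Ici]; linarith)
    (show 1 - z ∈ Ici (0 : ℝ) by simp only [mem_Ici]; linarith) (by linarith)
    (show 0 < (z - y) / (z - x) from div_pos (by linarith) hd)
    (show 0 < (y - x) / (z - x) from div_pos (by linarith) hd) (by field_simp; ring)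
  simp only [smul_eq_mul] at h
  set α := (z - y) / (z - x) with hα
  set β := (y - x) / (z - x) with hβ
  have hα0 : 0 ≤ α := (div_pos (by linarith) hd).le
  have hβ0 : 0 ≤ β := (div_pos (by linarith) hd).le
  have hy : α * (1 - x) + β * (1 - z) = 1 - y := by rw [hα, hβ]; field_simp; ring
  have hαβ : α + β = 1 := by rw [hα, hβ]; field_simp; ring
  rw [hy] at h
  by_contra! hc
  have h1 := hc.trans (min_le_left _ _)
  have h2 := hc.trans (min_le_right _ _)
  have h3 := add_le_add (mul_le_mul_of_nonneg_left h1 hα0) (mul_le_mul_of_nonneg_left h2 hβ0)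
  rw [← add_mul, hαβ] at h3
  linarith

/-- The logarithm of the ratio of the two terms in the derivative of `gl`. -/
noncomputable def logSlope (k : ℕ) (x : ℝ) : ℝ :=
  Real.log (k + 2 - 2 * x) + k * Real.log (1 - 2 * x) - (2 * k + 2) * Real.log (1 - x)
    - Real.log (k + 2)

theorem hasDerivAt_logSlope (k : ℕ) {x : ℝ} (h1 : x < 1 / 2) :
    HasDerivAt (logSlope k) (2 * (k + 1) * (1 - (k + 3) * x + 2 * x ^ 2) /
      ((k + 2 - 2 * x) * (1 - 2 * x) * (1 - x))) x := by
  have hk : (0 : ℝ) ≤ k := k.cast_nonneg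
  have e1 : (k : ℝ) + 2 - 2 * x ≠ 0 := by linarith
  have e2 : 1 - 2 * x ≠ 0 := by linarith
  have e3 : 1 - x ≠ 0 := by linarith
  have hid := hasDerivAt_id' x
  have := ((((hid.const_mul 2).const_sub ((k : ℝ) + 2)).log e1).add
    ((((hid.const_mul 2).const_sub 1).log e2).const_mul (k : ℝ))).sub
    (((hid.const_sub 1).log e3).const_mul (2 * (k : ℝ) + 2)) |>.sub_const (Real.log (k + 2))
  refine this.congr_deriv ?_
  field_simp
  ring

theorem strictQuasiconcave_logSlope (k : ℕ) {b : ℝ} (hb : b < 1 / 2) :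
    StrictQuasiconcave (logSlope k) 0 b := by
  have hk : (0 : ℝ) ≤ k := k.cast_nonneg
  refine strictQuasiconcave_of_hasDerivAt
    (fun x hx => hasDerivAt_logSlope k (hx.2.trans_lt hb)) ?_
  intro x y hx hxy hyb hy
  have pos : ∀ u, u < 1 / 2 → 0 < ((k : ℝ) + 2 - 2 * u) * (1 - 2 * u) * (1 - u) := fun u hu =>
    mul_pos (mul_pos (by linarith) (by linarith)) (by linarith)
  have hy' : 0 ≤ 1 - (k + 3) * y + 2 * y ^ 2 := by
    by_contra! hneg
    exact absurd hy (not_le.mpr (div_neg_of_neg_of_pos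
      (mul_neg_of_pos_of_neg (by positivity) hneg) (pos y (by linarith))))
  refine div_pos (mul_pos (by positivity) ?_) (pos x (by linarith))
  nlinarith [mul_pos (sub_pos.mpr hxy) (show (0 : ℝ) < (k : ℝ) + 3 - 2 * (x + y) by linarith)]

theorem strictQuasiconcave_gl {n : ℕ} (hn : 2 ≤ n) {b : ℝ} (hb : b < 1 / 2) :
    StrictQuasiconcave (gl n) 0 b := by
  obtain ⟨k, rfl⟩ : ∃ k, n = k + 2 := ⟨n - 2, by omega⟩
  have hk : (0 : ℝ) ≤ k := k.cast_nonneg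
  let h : ℝ → ℝ := fun x => (1 - x) ^ (k + 2) - (1 - 2 * x) ^ (k + 1) / (1 - x) ^ k
  let h' : ℝ → ℝ := fun x => (1 - x) ^ (k + 1) * (k + 2) * (Real.exp (logSlope k x) - 1)
  have hh : ∀ x ∈ Icc (0 : ℝ) b, gl (k + 2) x = h x := fun x hx => by
    rw [gl_eq ⟨hx.1, by linarith [hx.2]⟩, likelihood_self x (by omega),
      likelihood_zero (by linarith [hx.2]) (by omega)]
    have e : ((k + 2 : ℕ) : ℤ) - 2 = (k : ℤ) := by push_cast; ring
    rw [e, zpow_natCast]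
    rfl
  have hder : ∀ x ∈ Icc (0 : ℝ) b, HasDerivAt h (h' x) x := fun x hx => by
    have p1 : (0 : ℝ) < k + 2 - 2 * x := by linarith [hx.2]
    have p2 : 0 < 1 - 2 * x := by linarith [hx.2]
    have p3 : 0 < 1 - x := by linarith [hx.2]
    have hexp : Real.exp (logSlope k x)
        = (k + 2 - 2 * x) * (1 - 2 * x) ^ k / (1 - x) ^ (2 * k + 2) / (k + 2) := by
      rw [logSlope, Real.exp_sub, Real.exp_sub, Real.exp_add, Real.exp_log p1,
        Real.exp_log (by positivity : (0 : ℝ) < k + 2), mul_comm (k : ℝ), Real.exp_mul,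
        Real.exp_log p2, Real.rpow_natCast, mul_comm (2 * (k : ℝ) + 2), Real.exp_mul,
        Real.exp_log p3]
      norm_cast
    have hid := hasDerivAt_id' x
    have := ((hid.const_sub 1).pow (k + 2)).sub
      ((((hid.const_mul 2).const_sub 1).pow (k + 1)).div ((hid.const_sub 1).pow k)
        (pow_ne_zero k p3.ne'))
    refine this.congr_deriv ?_
    simp only [h', hexp]
    rcases k with _ | k
    · simp
      field_simp
      ring
    · push_cast
      simp only [Pi.pow_apply]
      field_simp
      ring
  have hq : StrictQuasiconcave h 0 b := by
    refine strictQuasiconcave_of_hasDerivAt hder ?_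
    intro x y hx hxy hyb hy
    have p : ∀ u, u ≤ b → 0 < (1 - u) ^ (k + 1) * ((k : ℝ) + 2) := fun u hu =>
      mul_pos (pow_pos (by linarith) _) (by positivity)
    have hy0 : 0 ≤ logSlope k y := by
      have := nonneg_of_mul_nonneg_right hy (p y hyb)
      rwa [sub_nonneg, Real.one_le_exp_iff] at this
    refine mul_pos (p x (by linarith)) ?_
    rw [sub_pos, Real.one_lt_exp_iff]
    have h0 : logSlope k 0 = 0 := by simp [logSlope]
    have := strictQuasiconcave_logSlope k hb 0 x y le_rfl hx hxy hyb
    rwa [h0, min_eq_left hy0] at this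
  intro x y z hx hxy hyz hz
  rw [hh x ⟨hx, by linarith⟩, hh y ⟨by linarith, by linarith⟩, hh z ⟨by linarith, hz⟩]
  exact hq x y z hx hxy hyz hz

/-! ### Intervals of given mass and their superlevel description -/

/-- Admissible intervals of mass `φ` in `[a, b]`. -/
def admissible (f g : ℝ → ℝ) (a b φ : ℝ) : Set (ℝ × ℝ) :=
  {p | a ≤ p.1 ∧ p.1 ≤ p.2 ∧ (0 < φ → p.1 < p.2) ∧ p.2 ≤ b ∧
    g a ≤ g p.1 ∧ g b ≤ g p.2 ∧ ∫ x in p.1..p.2, f x = φ}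

/-- Minimisers of `|g r - g s|` over the admissible intervals. -/
def IsCut (f g : ℝ → ℝ) (a b φ : ℝ) (p : ℝ × ℝ) : Prop :=
  p ∈ admissible f g a b φ ∧ IsMinOn (fun q : ℝ × ℝ => |g q.1 - g q.2|) (admissible f g a b φ) p

/-- `[r, s]` is the superlevel set `{g ≥ t}` within `[a, b]`, and has mass `φ`. -/
structure IsSuperlevel (f g : ℝ → ℝ) (a b φ t r s : ℝ) : Prop where
  min_le : min (g a) (g b) ≤ t
  left_le : a ≤ r
  le : r ≤ s
  le_right : s ≤ b
  le_iff : ∀ x ∈ Icc a b, t ≤ g x ↔ x ∈ Icc r s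
  mass : ∫ x in r..s, f x = φ

section

variable {f g : ℝ → ℝ} {a b φ t r s : ℝ}

theorem intervalIntegrable_of_subinterval (hf : IntervalIntegrable f volume a b) {u v : ℝ}
    (hu : a ≤ u) (huv : u ≤ v) (hv : v ≤ b) : IntervalIntegrable f volume u v :=
  hf.mono_set (by
    rw [uIcc_of_le huv, uIcc_of_le (hu.trans (huv.trans hv))]; exact Icc_subset_Icc hu hv)

theorem integral_nonneg_of_subinterval (hf0 : ∀ x ∈ Icc a b, 0 ≤ f x) {u v : ℝ}
    (hu : a ≤ u) (huv : u ≤ v) (hv : v ≤ b) : 0 ≤ ∫ x in u..v, f x :=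
  intervalIntegral.integral_nonneg huv fun x hx => hf0 x ⟨hu.trans hx.1, hx.2.trans hv⟩

theorem exists_isCut (hab : a ≤ b) (hf : IntervalIntegrable f volume a b)
    (hg : ContinuousOn g (Icc a b))
    (hend : (∀ x ∈ Icc a b, g a ≤ g x) ∨ ∀ x ∈ Icc a b, g b ≤ g x)
    (hφ : 0 ≤ φ) (hφ' : φ ≤ ∫ x in a..b, f x) : ∃ p, IsCut f g a b φ p := by
  have hprim : ContinuousOn (fun u => ∫ x in a..u, f x) (Icc a b) := by
    have := intervalIntegral.continuousOn_primitive_interval' hf left_mem_uIcc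
    rwa [uIcc_of_le hab] at this
  have hsub : ∀ u v, a ≤ u → u ≤ v → v ≤ b →
      (∫ x in a..v, f x) - ∫ x in a..u, f x = ∫ x in u..v, f x := fun u v hu huv hv =>
    intervalIntegral.integral_interval_sub_left
      (intervalIntegrable_of_subinterval hf le_rfl (hu.trans huv) hv)
      (intervalIntegrable_of_subinterval hf le_rfl hu (huv.trans hv))
  have hlt : ∀ u v : ℝ, u ≤ v → ∫ x in u..v, f x = φ → 0 < φ → u < v := by
    intro u v huv he hp
    refine huv.lt_of_ne ?_
    rintro rfl
    simp at he
    linarith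
  have hne : (admissible f g a b φ).Nonempty := by
    rcases hend with h | h
    · obtain ⟨r, hr, hr'⟩ := intermediate_value_Icc hab hprim
        (show (∫ x in a..b, f x) - φ ∈ Icc _ _ by simp; exact ⟨hφ', hφ⟩)
      have hm : ∫ x in r..b, f x = φ := by
        rw [← hsub r b hr.1 hr.2 le_rfl]; simp only at hr'; linarith
      exact ⟨(r, b), hr.1, hr.2, hlt _ _ hr.2 hm, le_rfl, h r hr, le_rfl, hm⟩
    · obtain ⟨s, hs, hs'⟩ := intermediate_value_Icc hab hprim
        (show φ ∈ Icc _ _ by simp; exact ⟨hφ, hφ'⟩)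
      exact ⟨(a, s), le_rfl, hs.1, hlt _ _ hs.1 hs', hs.2, le_rfl, h s hs, hs'⟩
  let T : Set (ℝ × ℝ) := (Icc a b ×ˢ Icc a b) ∩ {p | p.1 ≤ p.2}
  have hTc : IsClosed T := (isClosed_Icc.prod isClosed_Icc).inter
    (isClosed_le continuous_fst continuous_snd)
  have hT : IsCompact T := (isCompact_Icc.prod isCompact_Icc).inter_right
    (isClosed_le continuous_fst continuous_snd)
  have m1 : MapsTo Prod.fst T (Icc a b) := fun p hp => hp.1.1
  have m2 : MapsTo Prod.snd T (Icc a b) := fun p hp => hp.1.2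
  have g1 : ContinuousOn (fun p : ℝ × ℝ => g p.1) T := hg.comp continuousOn_fst m1
  have g2 : ContinuousOn (fun p : ℝ × ℝ => g p.2) T := hg.comp continuousOn_snd m2
  have i1 : ContinuousOn (fun p : ℝ × ℝ => ∫ x in a..p.1, f x) T :=
    hprim.comp continuousOn_fst m1
  have i2 : ContinuousOn (fun p : ℝ × ℝ => ∫ x in a..p.2, f x) T :=
    hprim.comp continuousOn_snd m2
  have hset : admissible f g a b φ =
      T ∩ ((T ∩ (fun p : ℝ × ℝ => g p.1) ⁻¹' Ici (g a)) ∩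
        ((T ∩ (fun p : ℝ × ℝ => g p.2) ⁻¹' Ici (g b)) ∩
        (T ∩ (fun p : ℝ × ℝ => (∫ x in a..p.2, f x) - ∫ x in a..p.1, f x) ⁻¹' {φ}))) := by
    ext ⟨u, v⟩
    constructor
    · rintro ⟨h1, h2, h3, h4, h5, h6, h7⟩
      have hp : (u, v) ∈ T := ⟨⟨⟨h1, h2.trans h4⟩, ⟨h1.trans h2, h4⟩⟩, h2⟩
      exact ⟨hp, ⟨hp, h5⟩, ⟨hp, h6⟩, hp, (hsub u v h1 h2 h4).trans h7⟩
    · rintro ⟨hp, ⟨-, h5⟩, ⟨-, h6⟩, -, h7⟩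
      have h1 := hp.1.1.1
      have h2 : u ≤ v := hp.2
      have h4 := hp.1.2.2
      have h8 := (hsub u v h1 h2 h4).symm.trans h7
      exact ⟨h1, h2, hlt u v h2 h8, h4, h5, h6, h8⟩
  have hcomp : IsCompact (admissible f g a b φ) := by
    rw [hset]
    exact hT.inter_right ((g1.preimage_isClosed_of_isClosed hTc isClosed_Ici).inter
      ((g2.preimage_isClosed_of_isClosed hTc isClosed_Ici).inter
        ((i2.sub i1).preimage_isClosed_of_isClosed hTc isClosed_singleton)))
  have hcont : ContinuousOn (fun q : ℝ × ℝ => |g q.1 - g q.2|) (admissible f g a b φ) :=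
    ((g1.sub g2).abs).mono (by rw [hset]; exact inter_subset_left)
  obtain ⟨p, hp, hmin⟩ := hcomp.exists_isMinOn hne hcont
  exact ⟨p, hp, hmin⟩

theorem StrictQuasiconcave.level_finite (hq : StrictQuasiconcave g a b) (t : ℝ) :
    {x | x ∈ Icc a b ∧ g x = t}.Finite := by
  set S := {x | x ∈ Icc a b ∧ g x = t} with hS
  by_contra hinf
  obtain ⟨u, huS, hu⟩ := Set.Infinite.exists_subset_card_eq hinf 3
  let e := u.orderEmbOfFin hu
  have he : ∀ i, e i ∈ S := fun i => huS (u.orderEmbOfFin_mem hu i)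
  have := hq (e 0) (e 1) (e 2) (he 0).1.1 (e.strictMono (by decide)) (e.strictMono (by decide))
    (he 2).1.2
  rw [(he 0).2, (he 1).2, (he 2).2] at this
  simp at this

theorem exists_isSuperlevel (hab : a ≤ b) (hf : IntervalIntegrable f volume a b)
    (hg : ContinuousOn g (Icc a b)) (hq : StrictQuasiconcave g a b)
    (hφ : 0 < φ) (hφ' : φ ≤ ∫ x in a..b, f x) : ∃ t r s, IsSuperlevel f g a b φ t r s := by
  let K : ℝ → Set ℝ := fun t => Icc a b ∩ g ⁻¹' Ici t
  have hK : ∀ t, IsClosed (K t) := fun t => hg.preimage_isClosed_of_isClosed isClosed_Icc isClosed_Ici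
  let G : ℝ → ℝ := fun t => ∫ x in a..b, (K t).indicator f x
  have hG : Continuous G := by
    rw [continuous_iff_continuousAt]
    intro t₀
    refine intervalIntegral.continuousAt_of_dominated_interval (bound := fun x => ‖f x‖)
      (Filter.Eventually.of_forall fun t => ?_) (Filter.Eventually.of_forall fun t => ?_)
      hf.norm ?_
    · rw [uIoc_of_le hab]
      exact hf.1.aestronglyMeasurable.indicator (hK t).measurableSet
    · exact Filter.Eventually.of_forall fun x _ => norm_indicator_le_norm_self _ _
    · have hnull := (hq.level_finite t₀).measure_zero volume
      filter_upwards [measure_eq_zero_iff_ae_notMem.mp hnull] with x hx hxab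
      rw [uIoc_of_le hab] at hxab
      have hx' : x ∈ Icc a b := ⟨hxab.1.le, hxab.2⟩
      have hne : g x ≠ t₀ := fun h => hx ⟨hx', h⟩
      rcases hne.lt_or_gt with h | h
      · refine (continuousAt_const (y := (0 : ℝ))).congr ?_
        filter_upwards [lt_mem_nhds h] with t ht
        rw [indicator_of_notMem]
        exact fun hm => absurd hm.2 (not_le.mpr ht)
      · refine (continuousAt_const (y := f x)).congr ?_
        filter_upwards [gt_mem_nhds h] with t ht
        rw [indicator_of_mem]
        exact ⟨hx', ht.le⟩
  obtain ⟨xm, hxm, hmax⟩ := isCompact_Icc.exists_isMaxOn (nonempty_Icc.mpr hab) hg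
  have hlow : ∀ x ∈ Icc a b, min (g a) (g b) ≤ g x := by
    intro x hx
    rcases hx.1.eq_or_lt with rfl | h1
    · exact min_le_left _ _
    rcases hx.2.eq_or_lt with rfl | h2
    · exact min_le_right _ _
    exact (hq a x b le_rfl h1 h2 le_rfl).le
  have hG0 : G (min (g a) (g b)) = ∫ x in a..b, f x := by
    refine intervalIntegral.integral_congr fun x hx => ?_
    rw [uIcc_of_le hab] at hx
    exact indicator_of_mem (show x ∈ K _ from ⟨hx, hlow x hx⟩) f
  have hG1 : G (g xm + 1) = 0 := by
    have : K (g xm + 1) = ∅ := by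
      ext x
      simp only [mem_empty_iff_false, iff_false]
      intro hx
      have h1 : g x ≤ g xm := hmax hx.1
      have h2 : g xm + 1 ≤ g x := hx.2
      linarith
    simp [G, this]
  obtain ⟨t, ht, hGt⟩ := intermediate_value_Icc' (by linarith [hlow xm hxm]) hG.continuousOn
    (show φ ∈ Icc (G (g xm + 1)) (G (min (g a) (g b))) by rw [hG0, hG1]; exact ⟨hφ.le, hφ'⟩)
  have hne : (K t).Nonempty := by
    by_contra h
    rw [not_nonempty_iff_eq_empty] at h
    simp [G, h] at hGt
    linarith
  have hKc : IsCompact (K t) := isCompact_Icc.of_isClosed_subset (hK t) inter_subset_left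
  obtain ⟨r, hr, hr'⟩ := hKc.exists_isLeast hne
  obtain ⟨s, hs, hs'⟩ := hKc.exists_isGreatest hne
  have hrs : r ≤ s := hr' hs
  have hiff : ∀ x ∈ Icc a b, t ≤ g x ↔ x ∈ Icc r s := by
    intro x hx
    constructor
    · intro h
      exact ⟨hr' ⟨hx, h⟩, hs' ⟨hx, h⟩⟩
    · rintro ⟨h1, h2⟩
      rcases h1.eq_or_lt with rfl | h1
      · exact hr.2
      rcases h2.eq_or_lt with rfl | h2
      · exact hs.2
      exact (le_min hr.2 hs.2).trans (hq r x s hr.1.1 h1 h2 hs.1.2).le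
  have hKI : K t = Icc r s := by
    ext x
    constructor
    · intro h
      exact (hiff x h.1).mp h.2
    · intro h
      have hx : x ∈ Icc a b := ⟨hr.1.1.trans h.1, h.2.trans hs.1.2⟩
      exact ⟨hx, (hiff x hx).mpr h⟩
  refine ⟨t, r, s, ht.1, hr.1.1, hrs, hs.1.2, hiff, ?_⟩
  rw [← hGt]
  simp only [G, hKI]
  rw [intervalIntegral.integral_of_le hab, intervalIntegral.integral_of_le hrs,
    ← integral_Icc_eq_integral_Ioc, ← integral_Icc_eq_integral_Ioc,
    setIntegral_indicator measurableSet_Icc,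
    inter_eq_self_of_subset_right (Icc_subset_Icc hr.1.1 hs.1.2)]

theorem IsSuperlevel.mem_admissible (h : IsSuperlevel f g a b φ t r s) :
    (r, s) ∈ admissible f g a b φ := by
  have hab : a ≤ b := h.left_le.trans (h.le.trans h.le_right)
  have hr := (h.le_iff r ⟨h.left_le, h.le.trans h.le_right⟩).mpr ⟨le_rfl, h.le⟩
  have hs := (h.le_iff s ⟨h.left_le.trans h.le, h.le_right⟩).mpr ⟨h.le, le_rfl⟩
  refine ⟨h.left_le, h.le, fun hφ => h.le.lt_of_ne ?_, h.le_right, ?_, ?_, h.mass⟩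
  · rintro rfl
    have := h.mass
    simp at this
    linarith
  · rcases h.left_le.eq_or_lt with e | hlt
    · rw [e]
    · refine (lt_of_not_ge fun hc => ?_).le.trans hr
      exact absurd ((h.le_iff a ⟨le_rfl, hab⟩).mp hc).1 (not_le.mpr hlt)
  · rcases h.le_right.eq_or_lt with e | hlt
    · rw [e]
    · refine (lt_of_not_ge fun hc => ?_).le.trans hs
      exact absurd ((h.le_iff b ⟨hab, le_rfl⟩).mp hc).2 (not_le.mpr hlt)

theorem IsSuperlevel.eq_left (h : IsSuperlevel f g a b φ t r s) (hg : ContinuousOn g (Icc a b))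
    (har : a < r) : g r = t := by
  have hrb := h.le.trans h.le_right
  have hr := (h.le_iff r ⟨h.left_le, hrb⟩).mpr ⟨le_rfl, h.le⟩
  have ha : g a ≤ t := by
    by_contra! hc
    exact absurd ((h.le_iff a ⟨le_rfl, har.le.trans hrb⟩).mp hc.le).1 (not_le.mpr har)
  obtain ⟨x, hx, hxt⟩ := intermediate_value_Icc har.le (hg.mono (Icc_subset_Icc le_rfl hrb))
    ⟨ha, hr⟩
  have := ((h.le_iff x ⟨hx.1, hx.2.trans hrb⟩).mp hxt.ge).1
  rw [← hxt, le_antisymm this hx.2]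

theorem IsSuperlevel.eq_right (h : IsSuperlevel f g a b φ t r s) (hg : ContinuousOn g (Icc a b))
    (hsb : s < b) : g s = t := by
  have has := h.left_le.trans h.le
  have hs := (h.le_iff s ⟨has, h.le_right⟩).mpr ⟨h.le, le_rfl⟩
  have hb : g b ≤ t := by
    by_contra! hc
    exact absurd ((h.le_iff b ⟨has.trans hsb.le, le_rfl⟩).mp hc.le).2 (not_le.mpr hsb)
  obtain ⟨x, hx, hxt⟩ := intermediate_value_Icc' hsb.le (hg.mono (Icc_subset_Icc has le_rfl))
    ⟨hb, hs⟩
  have := ((h.le_iff x ⟨has.trans hx.1, hx.2⟩).mp hxt.ge).2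
  rw [← hxt, le_antisymm this hx.1]

/-- A minimiser is nested with the superlevel interval of the same mass. -/
theorem IsCut.nested (hφ : 0 < φ) (hg : ContinuousOn g (Icc a b)) (hq : StrictQuasiconcave g a b)
    {p : ℝ × ℝ} (hp : IsCut f g a b φ p) (h : IsSuperlevel f g a b φ t r s) :
    (r ≤ p.1 ∧ p.2 ≤ s) ∨ (p.1 ≤ r ∧ s ≤ p.2) := by
  obtain ⟨⟨h1, -, h3, h4, h5, h6, -⟩, hmin⟩ := hp
  have hlt := h3 hφ
  have hmin : |g p.1 - g p.2| ≤ |g r - g s| := hmin h.mem_admissible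
  have hp1 : p.1 ∈ Icc a b := ⟨h1, by linarith⟩
  have hp2 : p.2 ∈ Icc a b := ⟨by linarith, h4⟩
  have hr := (h.le_iff r ⟨h.left_le, h.le.trans h.le_right⟩).mpr ⟨le_rfl, h.le⟩
  have hs := (h.le_iff s ⟨h.left_le.trans h.le, h.le_right⟩).mpr ⟨h.le, le_rfl⟩
  rcases h.left_le.eq_or_lt with har | har
  · rcases h.le_right.eq_or_lt with hsb | hsb
    · exact Or.inl ⟨har ▸ h1, hsb ▸ h4⟩
    · by_cases hc : p.2 ≤ s
      · exact Or.inl ⟨har ▸ h1, hc⟩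
      · exfalso
        have hlt2 : g p.2 < t := lt_of_not_ge fun hc' => hc ((h.le_iff _ hp2).mp hc').2
        rw [← har] at hmin hr
        rw [h.eq_right hg hsb, abs_of_nonneg (by linarith), abs_of_nonneg (by linarith)] at hmin
        linarith
  · rcases h.le_right.eq_or_lt with hsb | hsb
    · by_cases hc : r ≤ p.1
      · exact Or.inl ⟨hc, hsb ▸ h4⟩
      · exfalso
        have hlt2 : g p.1 < t := lt_of_not_ge fun hc' => hc ((h.le_iff _ hp1).mp hc').1
        rw [hsb] at hmin hs
        rw [h.eq_left hg har, abs_of_nonpos (by linarith), abs_of_nonpos (by linarith)] at hmin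
        linarith
    · rw [h.eq_left hg har, h.eq_right hg hsb, sub_self, abs_zero, abs_nonpos_iff, sub_eq_zero]
        at hmin
      by_cases hc : t ≤ g p.1
      · exact Or.inl ⟨((h.le_iff _ hp1).mp hc).1, ((h.le_iff _ hp2).mp (hmin ▸ hc)).2⟩
      · refine Or.inr ⟨?_, ?_⟩
        · by_contra! hc'
          have := hq r p.1 p.2 h.left_le hc' hlt h4
          rw [← hmin] at this
          rcases min_lt_iff.mp this with h' | h' <;> linarith
        · by_contra! hc'
          have := hq p.1 p.2 s h1 hlt hc' h.le_right
          rw [← hmin] at this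
          rcases min_lt_iff.mp this with h' | h' <;> linarith

theorem integral_split {u u' v' v : ℝ} (hf : IntervalIntegrable f volume u v) (h1 : u ≤ u')
    (h2 : u' ≤ v') (h3 : v' ≤ v) :
    ∫ x in u..v, f x = (∫ x in u..u', f x) + (∫ x in u'..v', f x) + ∫ x in v'..v, f x := by
  rw [intervalIntegral.integral_add_adjacent_intervals,
    intervalIntegral.integral_add_adjacent_intervals]
  · exact intervalIntegrable_of_subinterval hf le_rfl (h1.trans h2) h3
  · exact intervalIntegrable_of_subinterval hf (h1.trans h2) h3 le_rfl
  · exact intervalIntegrable_of_subinterval hf le_rfl h1 (h2.trans h3)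
  · exact intervalIntegrable_of_subinterval hf h1 h2 h3

theorem eq_of_nested_of_integral_eq {u u' v' v : ℝ} (hf : IntervalIntegrable f volume u v)
    (hpos : ∀ x y, u ≤ x → x < y → y ≤ v → 0 < ∫ x in x..y, f x)
    (h1 : u ≤ u') (h2 : u' ≤ v') (h3 : v' ≤ v)
    (heq : ∫ x in u..v, f x = ∫ x in u'..v', f x) : u = u' ∧ v' = v := by
  rw [integral_split hf h1 h2 h3] at heq
  have h0 : ∀ x y, u ≤ x → x ≤ y → y ≤ v → 0 ≤ ∫ x in x..y, f x := by
    intro x y hx hxy hy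
    rcases hxy.eq_or_lt with rfl | hxy
    · simp
    · exact (hpos x y hx hxy hy).le
  have n1 := h0 u u' le_rfl h1 (h2.trans h3)
  have n2 := h0 v' v (h1.trans h2) h3 le_rfl
  constructor
  · by_contra hc
    linarith [hpos u u' le_rfl (h1.lt_of_ne hc) (h2.trans h3)]
  · by_contra hc
    linarith [hpos v' v (h1.trans h2) (h3.lt_of_ne hc) le_rfl]

theorem integral_mul_eq_of_nested {u u' v' v : ℝ} (hf : IntervalIntegrable f volume u v)
    (hgf : IntervalIntegrable (fun x => g x * f x) volume u v)
    (hf0 : ∀ x ∈ Icc u v, 0 ≤ f x) (hg : MapsTo g (Icc u v) (Icc 0 1))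
    (h1 : u ≤ u') (h2 : u' ≤ v') (h3 : v' ≤ v)
    (heq : ∫ x in u..v, f x = ∫ x in u'..v', f x) :
    ∫ x in u..v, g x * f x = ∫ x in u'..v', g x * f x := by
  rw [integral_split hf h1 h2 h3] at heq
  rw [integral_split hgf h1 h2 h3]
  have n1 := integral_nonneg_of_subinterval hf0 le_rfl h1 (h2.trans h3)
  have n2 := integral_nonneg_of_subinterval hf0 (h1.trans h2) h3 le_rfl
  have key : ∀ x y, u ≤ x → x ≤ y → y ≤ v → ∫ x in x..y, f x = 0 →
      ∫ x in x..y, g x * f x = 0 := by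
    intro x y hx hxy hy h0
    refine le_antisymm ?_ (integral_nonneg_of_subinterval
      (fun z hz => mul_nonneg (hg hz).1 (hf0 z hz)) hx hxy hy)
    rw [← h0]
    refine intervalIntegral.integral_mono_on hxy
      (intervalIntegrable_of_subinterval hgf hx hxy hy)
      (intervalIntegrable_of_subinterval hf hx hxy hy) fun z hz => ?_
    have hz' : z ∈ Icc u v := ⟨hx.trans hz.1, hz.2.trans hy⟩
    exact mul_le_of_le_one_left (hf0 z hz') (hg hz').2
  rw [key u u' le_rfl h1 (h2.trans h3) (by linarith),
    key v' v (h1.trans h2) h3 le_rfl (by linarith), zero_add, add_zero]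

theorem existsUnique_isCut (hab : a ≤ b) (hf : IntervalIntegrable f volume a b)
    (hg : ContinuousOn g (Icc a b)) (hq : StrictQuasiconcave g a b)
    (hend : (∀ x ∈ Icc a b, g a ≤ g x) ∨ ∀ x ∈ Icc a b, g b ≤ g x)
    (hpos : ∀ u v, a ≤ u → u < v → v ≤ b → 0 < ∫ x in u..v, f x)
    (hφ : 0 < φ) (hφ' : φ ≤ ∫ x in a..b, f x) : ∃! p, IsCut f g a b φ p := by
  obtain ⟨t, r, s, h⟩ := exists_isSuperlevel hab hf hg hq hφ hφ'
  have key : ∀ p, IsCut f g a b φ p → p = (r, s) := by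
    intro p hp
    obtain ⟨h1, h2, -, h4, -, -, h7⟩ := hp.1
    rcases hp.nested hφ hg hq h with ⟨hr, hs⟩ | ⟨hr, hs⟩
    · obtain ⟨e1, e2⟩ := eq_of_nested_of_integral_eq
        (intervalIntegrable_of_subinterval hf h.left_le h.le h.le_right)
        (fun x y hx hxy hy => hpos x y (h.left_le.trans hx) hxy (hy.trans h.le_right))
        hr h2 hs (h.mass.trans h7.symm)
      exact Prod.ext e1.symm e2
    · obtain ⟨e1, e2⟩ := eq_of_nested_of_integral_eq
        (intervalIntegrable_of_subinterval hf h1 h2 h4)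
        (fun x y hx hxy hy => hpos x y (h1.trans hx) hxy (hy.trans h4))
        hr h.le hs (h7.trans h.mass.symm)
      exact Prod.ext e1 e2.symm
  obtain ⟨p, hp⟩ := exists_isCut hab hf hg hend hφ.le hφ'
  exact ⟨p, hp, fun q hq' => (key q hq').trans (key p hp).symm⟩

end

/-! ### The law of `X` -/

/-- `f` is a probability density on `[0, 1]`. -/
structure IsDensity (f : ℝ → ℝ) : Prop where
  integrable : IntervalIntegrable f volume 0 1
  nonneg : ∀ x ∈ Icc (0 : ℝ) 1, 0 ≤ f x
  integral_eq_one : ∫ x in (0 : ℝ)..1, f x = 1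

/-- The measure on `[0, 1]` with density `f`. -/
noncomputable def densityMeasure (f : ℝ → ℝ) : Measure ℝ :=
  (volume.restrict (Icc (0 : ℝ) 1)).withDensity (fun x => ENNReal.ofReal (f x))

section

variable {f : ℝ → ℝ}

theorem IsDensity.integrableOn (hf : IsDensity f) : IntegrableOn f (Icc 0 1) :=
  (intervalIntegrable_iff_integrableOn_Icc_of_le zero_le_one).mp hf.integrable

theorem IsDensity.setIntegral_Icc (hf : IsDensity f) {u v : ℝ} (hu : 0 ≤ u) (huv : u ≤ v)
    (hv : v ≤ 1) (h : ℝ → ℝ) :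
    ∫ x in Icc u v, h x ∂densityMeasure f = ∫ x in u..v, h x * f x := by
  have hsub : Icc u v ⊆ Icc 0 1 := Icc_subset_Icc hu hv
  rw [densityMeasure, setIntegral_withDensity_eq_setIntegral_toReal_smul₀
    (hf.integrableOn.aestronglyMeasurable.aemeasurable.ennreal_ofReal.mono_measure
      Measure.restrict_le_self)
    (Filter.Eventually.of_forall fun x => ENNReal.ofReal_lt_top) h measurableSet_Icc,
    Measure.restrict_restrict measurableSet_Icc, inter_eq_self_of_subset_left hsub,
    intervalIntegral.integral_of_le huv, ← integral_Icc_eq_integral_Ioc]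
  refine setIntegral_congr_fun measurableSet_Icc fun x hx => ?_
  simp only [smul_eq_mul]
  rw [ENNReal.toReal_ofReal (hf.nonneg x (hsub hx)), mul_comm]

theorem densityMeasure_compl_Icc : densityMeasure f (Icc 0 1)ᶜ = 0 :=
  withDensity_absolutelyContinuous _ _ (by
    rw [Measure.restrict_apply measurableSet_Icc.compl, compl_inter_self, measure_empty])

instance : NullSingletonClass (densityMeasure f) :=
  ⟨fun _ => withDensity_absolutelyContinuous _ _ (measure_singleton _)⟩

theorem IsDensity.isProbabilityMeasure (hf : IsDensity f) :
    IsProbabilityMeasure (densityMeasure f) := by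
  constructor
  rw [densityMeasure, withDensity_apply _ MeasurableSet.univ, Measure.restrict_univ,
    ← ofReal_integral_eq_lintegral_ofReal hf.integrableOn
      ((ae_restrict_iff' measurableSet_Icc).mpr (Filter.Eventually.of_forall hf.nonneg)),
    integral_Icc_eq_integral_Ioc, ← intervalIntegral.integral_of_le zero_le_one,
    hf.integral_eq_one, ENNReal.ofReal_one]

theorem IsDensity.real_Icc (hf : IsDensity f) {u v : ℝ} (hu : 0 ≤ u) (huv : u ≤ v)
    (hv : v ≤ 1) : (densityMeasure f).real (Icc u v) = ∫ x in u..v, f x := by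
  have := hf.setIntegral_Icc hu huv hv (fun _ => 1)
  simpa using this

theorem IsDensity.real_Ioo (hf : IsDensity f) {u v : ℝ} (hu : 0 ≤ u) (huv : u ≤ v)
    (hv : v ≤ 1) : (densityMeasure f).real (Ioo u v) = ∫ x in u..v, f x := by
  rw [← hf.real_Icc hu huv hv]
  exact measureReal_congr Ioo_ae_eq_Icc

theorem IsDensity.real_Iic (hf : IsDensity f) {u : ℝ} (hu : u ∈ Icc (0 : ℝ) 1) :
    (densityMeasure f).real (Iic u) = ∫ x in (0 : ℝ)..u, f x := by
  rw [← hf.real_Icc le_rfl hu.1 hu.2]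
  refine measureReal_congr ?_
  have := measure_eq_zero_iff_ae_notMem.mp (densityMeasure_compl_Icc (f := f))
  filter_upwards [this] with x hx
  rw [notMem_compl_iff] at hx
  exact propext ⟨fun h => ⟨hx.1, h⟩, fun h => h.2⟩

/-- The first marginal of a prior is determined by its distribution function. -/
theorem map_fst_eq_densityMeasure (hf : IsDensity f) {F : Measure (ℝ × ℝ)} (hF : IsPrior F)
    (h1 : PK1 f F) : F.map Prod.fst = densityMeasure f := by
  have := hF.1
  have := hf.isProbabilityMeasure
  have : IsProbabilityMeasure (F.map Prod.fst) :=
    Measure.isProbabilityMeasure_map measurable_fst.aemeasurable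
  have hsupp : F.map Prod.fst (Icc 0 1)ᶜ = 0 := by
    rw [Measure.map_apply measurable_fst measurableSet_Icc.compl]
    have hsub : Prod.fst ⁻¹' (Icc (0 : ℝ) 1)ᶜ ⊆ regionᶜ := fun p hp hr => hp ⟨hr.1, hr.2.1.le⟩
    exact measure_mono_null hsub hF.2
  have key : ∀ u ∈ Icc (0 : ℝ) 1, F.map Prod.fst (Iic u) = densityMeasure f (Iic u) := by
    intro u hu
    rw [← measureReal_eq_measureReal_iff, hf.real_Iic hu, ← h1 u hu,
      map_measureReal_apply measurable_fst measurableSet_Iic]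
    rfl
  refine Measure.ext_of_Iic _ _ fun u => ?_
  rcases lt_or_ge u 0 with hu | hu
  · have : Iic u ⊆ (Icc (0 : ℝ) 1)ᶜ := fun x hx hx' => absurd hx'.1 (not_le.mpr (hx.trans_lt hu))
    rw [measure_mono_null this hsupp, measure_mono_null this densityMeasure_compl_Icc]
  rcases le_or_gt u 1 with hu1 | hu1
  · exact key u ⟨hu, hu1⟩
  · have hIoc : Ioc 1 u ⊆ (Icc (0 : ℝ) 1)ᶜ := fun x hx hx' => absurd hx'.2 (not_le.mpr hx.1)
    have h2 : ∀ μ : Measure ℝ, μ (Icc 0 1)ᶜ = 0 → μ (Iic u) = μ (Iic 1) := fun μ hμ =>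
      le_antisymm (by
        rw [← Iic_union_Ioc_eq_Iic hu1.le]
        exact (measure_union_le _ _).trans (by rw [measure_mono_null hIoc hμ, add_zero]))
        (measure_mono (Iic_subset_Iic.mpr hu1.le))
    rw [h2 _ hsupp, h2 _ densityMeasure_compl_Icc, key 1 ⟨zero_le_one, le_rfl⟩]

theorem IsDensity.intervalIntegrable_mul (hf : IsDensity f) {u v : ℝ} (hu : 0 ≤ u) (huv : u ≤ v)
    (hv : v ≤ 1) {h : ℝ → ℝ} (hm : Measurable h) (hb : MapsTo h (Icc u v) (Icc 0 1)) :
    IntervalIntegrable (fun x => h x * f x) volume u v := by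
  rw [intervalIntegrable_iff_integrableOn_Icc_of_le huv]
  refine (hf.integrableOn.mono_set (Icc_subset_Icc hu hv)).bdd_mul (c := 1)
    hm.aestronglyMeasurable ?_
  refine (ae_restrict_iff' measurableSet_Icc).mpr (Filter.Eventually.of_forall fun x hx => ?_)
  rw [Real.norm_eq_abs, abs_of_nonneg (hb hx).1]
  exact (hb hx).2

/-! ### The bathtub inequality -/

theorem setIntegral_fst {F : Measure (ℝ × ℝ)} (hF : F.map Prod.fst = densityMeasure f)
    (hf : IsDensity f) {u v : ℝ} (hu : 0 ≤ u) (huv : u ≤ v) (hv : v ≤ 1) {h : ℝ → ℝ}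
    (hm : Measurable h) :
    ∫ p in {p : ℝ × ℝ | p.1 ∈ Icc u v}, h p.1 ∂F = ∫ x in u..v, h x * f x := by
  rw [← hf.setIntegral_Icc hu huv hv, ← hF,
    setIntegral_map measurableSet_Icc hm.aestronglyMeasurable measurable_fst.aemeasurable]
  rfl

theorem measurableSet_fst_mem_Icc (a b : ℝ) : MeasurableSet {p : ℝ × ℝ | p.1 ∈ Icc a b} :=
  measurable_fst measurableSet_Icc

/-- No event of mass at most `φ` carries more of `g` than a cut of mass `φ`. -/
theorem IsCut.setIntegral_le {g : ℝ → ℝ} {a b φ : ℝ} (hf : IsDensity f) (ha : 0 ≤ a)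
    (hab : a ≤ b) (hb : b ≤ 1) (hgm : Measurable g) (hg : ContinuousOn g (Icc a b))
    (hg01 : MapsTo g (Icc a b) (Icc 0 1))
    (hq : StrictQuasiconcave g a b ∨ ∀ x ∈ Icc a b, g x = 0)
    (hφ : 0 ≤ φ) (hφ' : φ ≤ ∫ x in a..b, f x) {p : ℝ × ℝ} (hp : IsCut f g a b φ p)
    {F : Measure (ℝ × ℝ)} [IsFiniteMeasure F] (hF : F.map Prod.fst = densityMeasure f)
    {S : Set (ℝ × ℝ)} (hS : MeasurableSet S) (hSab : S ⊆ {q | q.1 ∈ Icc a b})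
    (hSφ : F.real S ≤ φ) :
    ∫ q in S, g q.1 ∂F ≤ ∫ x in p.1..p.2, g x * f x := by
  obtain ⟨h1, h2, -, h4, -, -, h7⟩ := hp.1
  have hrhs : 0 ≤ ∫ x in p.1..p.2, g x * f x :=
    integral_nonneg_of_subinterval (a := a) (b := b) (fun x hx => mul_nonneg (hg01 hx).1
      (hf.nonneg x ⟨ha.trans hx.1, hx.2.trans hb⟩)) h1 h2 h4
  rcases hq with hq | hq
  swap
  · rw [setIntegral_congr_fun hS (g := fun _ => 0) fun q hq' => hq _ (hSab hq')]
    simpa using hrhs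
  rcases hφ.eq_or_lt with rfl | hφ
  · have : F S = 0 := by
      rw [← measureReal_eq_zero_iff]
      exact le_antisymm hSφ measureReal_nonneg
    rw [setIntegral_measure_zero _ this]
    exact hrhs
  have hfab : IntervalIntegrable f volume a b :=
    intervalIntegrable_of_subinterval hf.integrable ha hab hb
  have hgf := hf.intervalIntegrable_mul ha hab hb hgm hg01
  have hf0 : ∀ x ∈ Icc a b, 0 ≤ f x := fun x hx => hf.nonneg x ⟨ha.trans hx.1, hx.2.trans hb⟩
  obtain ⟨t, r, s, h⟩ := exists_isSuperlevel hab hfab hg hq hφ hφ'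
  have ht : 0 ≤ t := h.min_le.trans' (le_min (hg01 ⟨le_rfl, hab⟩).1 (hg01 ⟨hab, le_rfl⟩).1)
  have heq : ∫ x in p.1..p.2, g x * f x = ∫ x in r..s, g x * f x := by
    rcases hp.nested hφ hg hq h with ⟨hr, hs⟩ | ⟨hr, hs⟩
    · have hsub : Icc r s ⊆ Icc a b := Icc_subset_Icc h.left_le h.le_right
      exact (integral_mul_eq_of_nested
        (intervalIntegrable_of_subinterval hfab h.left_le h.le h.le_right)
        (intervalIntegrable_of_subinterval hgf h.left_le h.le h.le_right)
        (fun x hx => hf0 x (hsub hx)) (hg01.mono_left hsub)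
        hr h2 hs (h.mass.trans h7.symm)).symm
    · have hsub : Icc p.1 p.2 ⊆ Icc a b := Icc_subset_Icc h1 h4
      exact integral_mul_eq_of_nested (intervalIntegrable_of_subinterval hfab h1 h2 h4)
        (intervalIntegrable_of_subinterval hgf h1 h2 h4)
        (fun x hx => hf0 x (hsub hx)) (hg01.mono_left hsub)
        hr h.le hs (h7.trans h.mass.symm)
  have hr0 : 0 ≤ r := ha.trans h.left_le
  have hs1 : s ≤ 1 := h.le_right.trans hb
  have hgI : IntegrableOn (fun q : ℝ × ℝ => g q.1) {q | q.1 ∈ Icc a b} F := by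
    refine Integrable.of_bound (hgm.comp measurable_fst).aestronglyMeasurable 1 ?_
    refine (ae_restrict_iff' (measurableSet_fst_mem_Icc a b)).mpr
      (Filter.Eventually.of_forall fun q hq' => ?_)
    rw [Real.norm_eq_abs, abs_of_nonneg (hg01 hq').1]
    exact (hg01 hq').2
  let R : Set (ℝ × ℝ) := {q | q.1 ∈ Icc r s}
  have hR : MeasurableSet R := measurableSet_fst_mem_Icc r s
  have hRab : R ⊆ {q | q.1 ∈ Icc a b} := fun q hq' =>
    Icc_subset_Icc h.left_le h.le_right hq'
  have hdiff : ∀ A ⊆ {q : ℝ × ℝ | q.1 ∈ Icc a b},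
      IntegrableOn (fun q : ℝ × ℝ => g q.1 - t) A F :=
    fun A hA => (hgI.mono_set hA).sub (integrableOn_const (measure_ne_top _ _))
  have hmono : ∫ q in S, (g q.1 - t) ∂F ≤ ∫ q in R, (g q.1 - t) ∂F := by
    rw [← integral_indicator hS, ← integral_indicator hR]
    refine integral_mono ((hdiff S hSab).integrable_indicator hS)
      ((hdiff R hRab).integrable_indicator hR) fun q => ?_
    have hRiff : q ∈ S → (t ≤ g q.1 ↔ q ∈ R) := fun hqS => h.le_iff _ (hSab hqS)
    have hRle : q ∈ R → t ≤ g q.1 := fun hqR => (h.le_iff _ (hRab hqR)).mpr hqR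
    by_cases hqS : q ∈ S <;> by_cases hqR : q ∈ R <;> simp only [hqS, hqR, indicator_of_mem,
      indicator_of_notMem, not_false_eq_true, le_refl]
    · exact sub_nonpos.mpr (le_of_not_ge fun hc => hqR ((hRiff hqS).mp hc))
    · exact sub_nonneg.mpr (hRle hqR)
  have hRφ : F.real R = φ := by
    rw [← h.mass, ← hf.real_Icc hr0 h.le hs1, ← hF,
      map_measureReal_apply measurable_fst measurableSet_Icc]
    rfl
  rw [integral_sub (hgI.mono_set hSab) (integrableOn_const (measure_ne_top _ _)),
    integral_sub (hgI.mono_set hRab) (integrableOn_const (measure_ne_top _ _)),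
    setIntegral_const, setIntegral_const, hRφ, setIntegral_fst hF hf hr0 h.le hs1 hgm] at hmono
  rw [heq]
  simp only [smul_eq_mul] at hmono
  nlinarith [mul_le_mul_of_nonneg_right hSφ ht]

end

/-! ### Posterior confidence -/

section

variable {f : ℝ → ℝ}

theorem integrable_likelihood {n : ℕ} (hn : 1 ≤ n) {F : Measure (ℝ × ℝ)} (hF : IsPrior F) :
    Integrable (fun p : ℝ × ℝ => likelihood p.1 p.2 n) F := by
  have := hF.1
  refine Integrable.of_bound (measurable_likelihood hn).aestronglyMeasurable 1 ?_
  filter_upwards [measure_eq_zero_iff_ae_notMem.mp hF.2] with p hp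
  rw [notMem_compl_iff] at hp
  rw [Real.norm_eq_abs, abs_of_nonneg (likelihood_nonneg hn hp)]
  exact likelihood_le_one hn hp

theorem integral_likelihood_eq_add (hf : IsDensity f) {n : ℕ} (hn : 1 ≤ n) {b : ℝ}
    {F : Measure (ℝ × ℝ)} (hF : IsPrior F) (h1 : PK1 f F) :
    ∫ p, likelihood p.1 p.2 n ∂F =
      (∫ p in {p : ℝ × ℝ | p.1 ∈ Icc 0 b}, likelihood p.1 p.2 n ∂F) +
        ∫ p in {p : ℝ × ℝ | p.1 ∈ Icc b 1}, likelihood p.1 p.2 n ∂F := by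
  rw [← integral_add_compl (measurableSet_fst_mem_Icc 0 b) (integrable_likelihood hn hF)]
  congr 1
  refine setIntegral_congr_set ?_
  have hb : F {p | p.1 = b} = 0 := by
    have : (F.map Prod.fst) {b} = 0 := by
      rw [map_fst_eq_densityMeasure hf hF h1, measure_singleton]
    rwa [Measure.map_apply measurable_fst (measurableSet_singleton b)] at this
  filter_upwards [measure_eq_zero_iff_ae_notMem.mp hF.2, measure_eq_zero_iff_ae_notMem.mp hb]
    with p hp hpb
  rw [notMem_compl_iff] at hp
  refine propext ⟨fun h => ⟨le_of_not_ge fun hc => h ⟨hp.1, hc⟩, hp.2.1.le⟩, fun h h' => ?_⟩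
  exact hpb (le_antisymm h'.2 h.1)

theorem pow_one_sub_mapsTo (n : ℕ) : MapsTo (fun x : ℝ => (1 - x) ^ n) (Icc 0 1) (Icc 0 1) :=
  fun x hx => ⟨pow_nonneg (by linarith [hx.2]) n,
    pow_le_one₀ (by linarith [hx.2]) (by linarith [hx.1])⟩

theorem intervalIntegral_indicator_Ioo {a b u v : ℝ} (hau : a ≤ u) (huv : u ≤ v) (hvb : v ≤ b)
    (h : ℝ → ℝ) : ∫ x in a..b, (Ioo u v).indicator h x = ∫ x in u..v, h x := by
  rw [intervalIntegral.integral_of_le (hau.trans (huv.trans hvb)),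
    intervalIntegral.integral_of_le huv, setIntegral_indicator measurableSet_Ioo,
    inter_eq_self_of_subset_right (Ioo_subset_Ioc_self.trans (Ioc_subset_Ioc hau hvb)),
    integral_Ioc_eq_integral_Ioo]

theorem isLowerCut_iff {b φ : ℝ} {n : ℕ} {p : ℝ × ℝ} :
    IsLowerCut f b φ n p ↔ IsCut f (gl n) 0 b φ p := Iff.rfl

theorem isUpperCut_iff {b φ : ℝ} {n : ℕ} {p : ℝ × ℝ} :
    IsUpperCut f b φ n p ↔ IsCut f (gu n) b 1 φ p := Iff.rfl

theorem intervalIntegrable_indicator_Ioo {a b u v : ℝ} {h : ℝ → ℝ} (hab : a ≤ b)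
    (hh : IntervalIntegrable h volume a b) :
    IntervalIntegrable ((Ioo u v).indicator h) volume a b := by
  rw [intervalIntegrable_iff_integrableOn_Icc_of_le hab] at hh ⊢
  exact hh.indicator measurableSet_Ioo

theorem Qden_eq (hf : IsDensity f) {n : ℕ} (hn : 1 ≤ n) {b : ℝ} (hb : b < 1 / 2) {c : ℝ × ℝ}
    (h0 : 0 ≤ c.1) (h1 : c.1 ≤ c.2) (h2 : c.2 ≤ b) :
    Qden f b n c = (∫ x in (0 : ℝ)..b, (1 - x) ^ n * f x) - ∫ x in c.1..c.2, gl n x * f x := by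
  have hb0 : 0 ≤ b := h0.trans (h1.trans h2)
  have hg := hf.intervalIntegrable_mul le_rfl hb0 (by linarith) (measurable_gl hn)
    ((gl_mapsTo hn).mono_left (Icc_subset_Icc le_rfl hb.le))
  have hp := hf.intervalIntegrable_mul le_rfl hb0 (by linarith)
    (h := fun x : ℝ => (1 - x) ^ n) (by fun_prop)
    ((pow_one_sub_mapsTo n).mono_left (Icc_subset_Icc le_rfl (by linarith)))
  rw [← intervalIntegral_indicator_Ioo h0 h1 h2,
    ← intervalIntegral.integral_sub hp (intervalIntegrable_indicator_Ioo hb0 hg), Qden]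
  refine intervalIntegral.integral_congr_ae ?_
  have hfin : ({c.1, c.2, b} : Set ℝ).Finite := by simp
  filter_upwards [measure_eq_zero_iff_ae_notMem.mp (hfin.measure_zero volume)] with x hx hxb
  rw [uIoc_of_le hb0] at hxb
  simp only [mem_insert_iff, mem_singleton_iff, not_or] at hx
  obtain ⟨hx1, hx2, hx3⟩ := hx
  by_cases hc : x ∈ Ioo c.1 c.2
  · have hn' : x ∉ Ioo 0 c.1 ∪ Ioo c.2 b := by
      rintro (h | h)
      · linarith [h.2, hc.1]
      · linarith [h.1, hc.2]
    have hl : gl n x = (1 - x) ^ n - (1 - 2 * x) ^ (n - 1) / (1 - x) ^ ((n : ℤ) - 2) := by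
      rw [gl_eq ⟨hxb.1.le, by linarith [hxb.2]⟩, likelihood_self x hn,
        likelihood_zero (by linarith [hxb.2]) hn]
    rw [indicator_of_mem hc, indicator_of_notMem hn', indicator_of_mem hc, hl]
    simp only [Pi.one_apply]
    ring
  · have hm : x ∈ Ioo 0 c.1 ∪ Ioo c.2 b := by
      rcases lt_or_gt_of_ne hx1 with h | h
      · exact Or.inl ⟨hxb.1, h⟩
      · exact Or.inr ⟨lt_of_le_of_ne (le_of_not_gt fun h' => hc ⟨h, h'⟩) (Ne.symm hx2),
          lt_of_le_of_ne hxb.2 hx3⟩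
    rw [indicator_of_mem hm, indicator_of_notMem hc, indicator_of_notMem hc]
    simp

theorem Qnum_eq (hf : IsDensity f) {n : ℕ} (hn : 1 ≤ n) {b : ℝ} (hb : 0 ≤ b) {d : ℝ × ℝ}
    (h0 : b ≤ d.1) (h1 : d.1 ≤ d.2) (h2 : d.2 ≤ 1) :
    Qnum f b n d = (∫ x in b..1, (1 - x) ^ n * f x) + ∫ x in d.1..d.2, gu n x * f x := by
  have hb1 : b ≤ 1 := h0.trans (h1.trans h2)
  have hg := hf.intervalIntegrable_mul hb hb1 le_rfl (measurable_gu hn)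
    ((gu_mapsTo hn).mono_left (Icc_subset_Icc hb le_rfl))
  have hp := hf.intervalIntegrable_mul hb hb1 le_rfl
    (h := fun x : ℝ => (1 - x) ^ n) (by fun_prop)
    ((pow_one_sub_mapsTo n).mono_left (Icc_subset_Icc hb le_rfl))
  rw [← intervalIntegral_indicator_Ioo h0 h1 h2,
    ← intervalIntegral.integral_add hp (intervalIntegrable_indicator_Ioo hb1 hg), Qnum]
  refine intervalIntegral.integral_congr_ae ?_
  have hfin : ({d.1, d.2, 1} : Set ℝ).Finite := by simp
  filter_upwards [measure_eq_zero_iff_ae_notMem.mp (hfin.measure_zero volume)] with x hx hxb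
  rw [uIoc_of_le hb1] at hxb
  simp only [mem_insert_iff, mem_singleton_iff, not_or] at hx
  obtain ⟨hx1, hx2, hx3⟩ := hx
  by_cases hd : x ∈ Ioo d.1 d.2
  · have hn' : x ∉ Ioo b d.1 ∪ Ioo d.2 1 := by
      rintro (h | h)
      · linarith [h.2, hd.1]
      · linarith [h.1, hd.2]
    rw [indicator_of_mem hd, indicator_of_notMem hn', indicator_of_mem hd,
      gu_eq_sub_pow hn ⟨by linarith [hxb.1], hxb.2⟩]
    simp only [Pi.one_apply]
    ring
  · have hm : x ∈ Ioo b d.1 ∪ Ioo d.2 1 := by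
      rcases lt_or_gt_of_ne hx1 with h | h
      · exact Or.inl ⟨hxb.1, h⟩
      · exact Or.inr ⟨lt_of_le_of_ne (le_of_not_gt fun h' => hd ⟨h, h'⟩) (Ne.symm hx2),
          lt_of_le_of_ne hxb.2 hx3⟩
    rw [indicator_of_mem hm, indicator_of_notMem hd, indicator_of_notMem hd]
    simp

/-! ### The extreme prior -/

theorem measurable_extremeLam (c d : ℝ × ℝ) : Measurable (extremeLam c d) := by
  unfold extremeLam
  exact Measurable.ite measurableSet_Ioo measurable_const
    (Measurable.ite measurableSet_Ioo measurable_const measurable_id)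

theorem extremePrior_eq (c d : ℝ × ℝ) :
    extremePrior f c d = (densityMeasure f).map (fun x => (x, extremeLam c d x)) := rfl

theorem measurable_graph_extremeLam (c d : ℝ × ℝ) :
    Measurable (fun x => (x, extremeLam c d x)) :=
  measurable_id.prodMk (measurable_extremeLam c d)

theorem extremeLam_of_mem_left {c d : ℝ × ℝ} {x : ℝ} (h : x ∈ Ioo c.1 c.2) :
    extremeLam c d x = 0 := by
  rw [extremeLam, if_pos h]

theorem extremeLam_of_mem_right {c d : ℝ × ℝ} (hcd : c.2 ≤ d.1) {x : ℝ} (h : x ∈ Ioo d.1 d.2) :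
    extremeLam c d x = 1 := by
  have : x ∉ Ioo c.1 c.2 := fun h' => by linarith [h.1, h'.2]
  rw [extremeLam, if_neg this, if_pos h]

theorem extremeLam_of_notMem {c d : ℝ × ℝ} {x : ℝ} (h : x ∉ Ioo c.1 c.2) (h' : x ∉ Ioo d.1 d.2) :
    extremeLam c d x = x := by
  rw [extremeLam, if_neg h, if_neg h']

theorem extremeLam_lt_iff {c d : ℝ × ℝ} (hc : 0 ≤ c.1) (hcd : c.2 ≤ d.1) (hd : d.2 ≤ 1) (x : ℝ) :
    extremeLam c d x < x ↔ x ∈ Ioo c.1 c.2 := by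
  by_cases h : x ∈ Ioo c.1 c.2
  · simp only [extremeLam_of_mem_left h, h, iff_true]
    exact hc.trans_lt h.1
  by_cases h' : x ∈ Ioo d.1 d.2
  · simp only [extremeLam_of_mem_right hcd h', h, iff_false]
    linarith [h'.2]
  · simp [extremeLam_of_notMem h h', h]

theorem lt_extremeLam_iff {c d : ℝ × ℝ} (hc : 0 ≤ c.1) (hcd : c.2 ≤ d.1) (hd : d.2 ≤ 1) (x : ℝ) :
    x < extremeLam c d x ↔ x ∈ Ioo d.1 d.2 := by
  by_cases h' : x ∈ Ioo d.1 d.2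
  · simp only [extremeLam_of_mem_right hcd h', h', iff_true]
    linarith [h'.2]
  by_cases h : x ∈ Ioo c.1 c.2
  · simp only [extremeLam_of_mem_left h, h', iff_false]
    linarith [h.1]
  · simp [extremeLam_of_notMem h h', h']

theorem graph_extremeLam_mem_region {c d : ℝ × ℝ} (hc : c.2 ≤ 1 / 2) (hcd : c.2 ≤ d.1) {x : ℝ}
    (h0 : 0 ≤ x) (h1 : x < 1) : (x, extremeLam c d x) ∈ region := by
  by_cases h : x ∈ Ioo c.1 c.2
  · rw [extremeLam_of_mem_left h]
    exact zero_mem_region h0 (by linarith [h.2])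
  by_cases h' : x ∈ Ioo d.1 d.2
  · rw [extremeLam_of_mem_right hcd h']
    exact one_mem_region h0 h1
  · rw [extremeLam_of_notMem h h']
    exact self_mem_region h0 h1

theorem extremePrior_real (c d : ℝ × ℝ) {S : Set (ℝ × ℝ)} (hS : MeasurableSet S) :
    (extremePrior f c d).real S = (densityMeasure f).real {x | (x, extremeLam c d x) ∈ S} := by
  rw [extremePrior_eq, map_measureReal_apply (measurable_graph_extremeLam c d) hS]
  rfl

theorem extremePrior_isPrior (hf : IsDensity f) {c d : ℝ × ℝ} (hc : c.2 ≤ 1 / 2)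
    (hcd : c.2 ≤ d.1) : IsPrior (extremePrior f c d) := by
  have := hf.isProbabilityMeasure
  refine ⟨extremePrior_eq (f := f) c d ▸ Measure.isProbabilityMeasure_map
    (measurable_graph_extremeLam c d).aemeasurable, ?_⟩
  have h : ∀ᵐ x ∂densityMeasure f, (x, extremeLam c d x) ∈ region := by
    filter_upwards [measure_eq_zero_iff_ae_notMem.mp (densityMeasure_compl_Icc (f := f)),
      measure_eq_zero_iff_ae_notMem.mp (measure_singleton (μ := densityMeasure f) 1)] with x hx hx1
    rw [notMem_compl_iff] at hx
    exact graph_extremeLam_mem_region hc hcd hx.1 (lt_of_le_of_ne hx.2 hx1)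
  have hmeas : MeasurableSet region := by
    have e1 : Measurable fun p : ℝ × ℝ => max 0 ((2 * p.1 - 1) / p.1) := by fun_prop
    exact (measurableSet_le measurable_const measurable_fst).inter
      ((measurableSet_lt measurable_fst measurable_const).inter
        ((measurableSet_le e1 measurable_snd).inter
          (measurableSet_le measurable_snd measurable_const)))
  rw [extremePrior_eq, Measure.map_apply (measurable_graph_extremeLam c d) hmeas.compl]
  exact ae_iff.mp h

theorem extremePrior_PK1 (hf : IsDensity f) (c d : ℝ × ℝ) : PK1 f (extremePrior f c d) := by
  intro u hu
  rw [← hf.real_Iic hu, extremePrior_real c d (measurableSet_le measurable_fst measurable_const)]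
  rfl

theorem extremePrior_mem_feasiblePriors (hf : IsDensity f) {b φ₁ φ₂ : ℝ} (hb0 : 0 ≤ b)
    (hb : b ≤ 1 / 2) {c d : ℝ × ℝ} (hc0 : 0 ≤ c.1) (hc1 : c.1 ≤ c.2) (hc2 : c.2 ≤ b)
    (hd0 : b ≤ d.1) (hd1 : d.1 ≤ d.2) (hd2 : d.2 ≤ 1)
    (hcm : ∫ x in c.1..c.2, f x = φ₁) (hdm : ∫ x in d.1..d.2, f x = φ₂)
    (h1 : φ₁ ≤ ∫ x in (0 : ℝ)..b, f x) (h2 : ∫ x in (0 : ℝ)..b, f x ≤ 1 - φ₂) :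
    extremePrior f c d ∈ feasiblePriors f b φ₁ φ₂ := by
  have hcd : c.2 ≤ d.1 := hc2.trans hd0
  have hPK1 := extremePrior_PK1 hf c d
  refine ⟨extremePrior_isPrior hf (hc2.trans hb) hcd, hPK1, ?_, ?_, ?_⟩
  · rw [PK2, extremePrior_real c d (measurableSet_lt measurable_snd measurable_fst), ← hcm,
      ← hf.real_Ioo hc0 hc1 (by linarith)]
    congr 1
    ext x
    exact extremeLam_lt_iff hc0 hcd hd2 x
  · rw [PK3, extremePrior_real c d (measurableSet_lt measurable_fst measurable_snd), ← hdm,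
      ← hf.real_Ioo (by linarith) hd1 hd2]
    congr 1
    ext x
    exact lt_extremeLam_iff hc0 hcd hd2 x
  · rw [PK4, hPK1 b ⟨hb0, by linarith⟩]
    exact ⟨h1, h2⟩

theorem setIntegral_extremePrior (hf : IsDensity f) {n : ℕ} (hn : 1 ≤ n) (c d : ℝ × ℝ) {u v : ℝ}
    (hu : 0 ≤ u) (huv : u ≤ v) (hv : v ≤ 1) :
    ∫ p in {p : ℝ × ℝ | p.1 ∈ Icc u v}, likelihood p.1 p.2 n ∂extremePrior f c d =
      ∫ x in u..v, likelihood x (extremeLam c d x) n * f x := by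
  rw [← hf.setIntegral_Icc hu huv hv, extremePrior_eq,
    setIntegral_map (measurableSet_fst_mem_Icc u v)
      (measurable_likelihood hn).aestronglyMeasurable
      (measurable_graph_extremeLam c d).aemeasurable]
  rfl

theorem setIntegral_extremePrior_left (hf : IsDensity f) {n : ℕ} (hn : 1 ≤ n) {b : ℝ}
    (hb : b < 1 / 2) {c d : ℝ × ℝ} (h0 : 0 ≤ c.1) (h1 : c.1 ≤ c.2) (h2 : c.2 ≤ b)
    (h3 : b ≤ d.1) :
    ∫ p in {p : ℝ × ℝ | p.1 ∈ Icc 0 b}, likelihood p.1 p.2 n ∂extremePrior f c d =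
      Qden f b n c := by
  have hb0 : 0 ≤ b := h0.trans (h1.trans h2)
  have hg := hf.intervalIntegrable_mul le_rfl hb0 (by linarith) (measurable_gl hn)
    ((gl_mapsTo hn).mono_left (Icc_subset_Icc le_rfl hb.le))
  have hp := hf.intervalIntegrable_mul le_rfl hb0 (by linarith)
    (h := fun x : ℝ => (1 - x) ^ n) (by fun_prop)
    ((pow_one_sub_mapsTo n).mono_left (Icc_subset_Icc le_rfl (by linarith)))
  rw [setIntegral_extremePrior hf hn c d le_rfl hb0 (by linarith), Qden_eq hf hn hb h0 h1 h2,
    ← intervalIntegral_indicator_Ioo h0 h1 h2,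
    ← intervalIntegral.integral_sub hp (intervalIntegrable_indicator_Ioo hb0 hg)]
  refine intervalIntegral.integral_congr fun x hx => ?_
  rw [uIcc_of_le hb0] at hx
  by_cases hc : x ∈ Ioo c.1 c.2
  · simp only [indicator_of_mem hc, extremeLam_of_mem_left hc]
    rw [gl_eq ⟨hx.1, by linarith [hx.2]⟩, likelihood_self x hn]
    ring
  · have hd : x ∉ Ioo d.1 d.2 := fun h => by linarith [h.1, hx.2]
    simp only [indicator_of_notMem hc, extremeLam_of_notMem hc hd]
    rw [likelihood_self x hn, sub_zero]

theorem setIntegral_extremePrior_right (hf : IsDensity f) {n : ℕ} (hn : 1 ≤ n) {b : ℝ}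
    (hb : 0 ≤ b) {c d : ℝ × ℝ} (h0 : b ≤ d.1) (h1 : d.1 ≤ d.2) (h2 : d.2 ≤ 1)
    (h3 : c.2 ≤ b) :
    ∫ p in {p : ℝ × ℝ | p.1 ∈ Icc b 1}, likelihood p.1 p.2 n ∂extremePrior f c d =
      Qnum f b n d := by
  have hb1 : b ≤ 1 := h0.trans (h1.trans h2)
  have hg := hf.intervalIntegrable_mul hb hb1 le_rfl (measurable_gu hn)
    ((gu_mapsTo hn).mono_left (Icc_subset_Icc hb le_rfl))
  have hp := hf.intervalIntegrable_mul hb hb1 le_rfl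
    (h := fun x : ℝ => (1 - x) ^ n) (by fun_prop)
    ((pow_one_sub_mapsTo n).mono_left (Icc_subset_Icc hb le_rfl))
  rw [setIntegral_extremePrior hf hn c d hb hb1 le_rfl, Qnum_eq hf hn hb h0 h1 h2,
    ← intervalIntegral_indicator_Ioo h0 h1 h2,
    ← intervalIntegral.integral_add hp (intervalIntegrable_indicator_Ioo hb1 hg)]
  refine intervalIntegral.integral_congr fun x hx => ?_
  rw [uIcc_of_le hb1] at hx
  by_cases hd : x ∈ Ioo d.1 d.2
  · simp only [indicator_of_mem hd, extremeLam_of_mem_right (h3.trans h0) hd]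
    rw [gu_eq ⟨hb.trans hx.1, hx.2⟩, likelihood_self x hn]
    ring
  · have hc : x ∉ Ioo c.1 c.2 := fun h => by linarith [h.2, hx.1]
    simp only [indicator_of_notMem hd, extremeLam_of_notMem hc hd]
    rw [likelihood_self x hn, add_zero]

theorem Qden_pos (hf : IsDensity f) {n : ℕ} (hn : 1 ≤ n) {b : ℝ}
    (hb : b < 1 / 2) {c : ℝ × ℝ} (h0 : 0 ≤ c.1) (h1 : c.1 ≤ c.2) (h2 : c.2 ≤ b)
    (hpos : 0 < ∫ x in (0 : ℝ)..b, f x) : 0 < Qden f b n c := by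
  have hb0 : 0 ≤ b := h0.trans (h1.trans h2)
  let κ : ℝ := (1 - b) * (1 - (1 - 0) * b / (1 - b)) ^ (n - 1)
  have hκ : 0 < κ := by
    refine mul_pos (by linarith) (pow_pos ?_ _)
    rw [sub_pos, div_lt_one (by linarith)]
    linarith
  let d : ℝ × ℝ := (1, 1)
  have hcd : c.2 ≤ d.1 := h2.trans (by simp only [d]; linarith)
  rw [← setIntegral_extremePrior_left hf hn hb h0 h1 h2 (d := d) (by simp only [d]; linarith),
    setIntegral_extremePrior hf hn c d le_rfl hb0 (by linarith)]
  have hle : ∀ x ∈ Icc 0 b, κ ≤ likelihood x (extremeLam c d x) n := by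
    intro x hx
    have hx1 : x < 1 := by linarith [hx.2]
    have hz : (x, (0 : ℝ)) ∈ region := zero_mem_region hx.1 (by linarith [hx.2])
    refine le_trans ?_ (likelihood_le_of_le hn hz ?_)
    · rw [likelihood_eq x 0 n hn]
      have e0 : 0 ≤ 1 - (1 - 0) * b / (1 - b) := by
        rw [sub_nonneg, div_le_one (by linarith)]
        linarith
      have e1 : (1 - 0) * x / (1 - x) ≤ (1 - 0) * b / (1 - b) := by
        have e2 : 0 < 1 - b := by linarith
        have e3 : 0 ≤ (1 - 0) * b := by linarith
        gcongr
        · exact hx.2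
        · exact hx.2
      exact mul_le_mul (by linarith [hx.2]) (pow_le_pow_left₀ e0 (by linarith) _)
        (pow_nonneg e0 _) (by linarith)
    · have := graph_extremeLam_mem_region (h2.trans hb.le) hcd hx.1 hx1
      exact (le_max_left _ _).trans this.2.2.1
  have hint : IntervalIntegrable f volume 0 b :=
    intervalIntegrable_of_subinterval hf.integrable le_rfl hb0 (by linarith)
  have hlm : Measurable fun x => likelihood x (extremeLam c d x) n :=
    (measurable_likelihood hn).comp (measurable_graph_extremeLam c d)
  calc 0 < κ * ∫ x in (0 : ℝ)..b, f x := mul_pos hκ hpos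
    _ = ∫ x in (0 : ℝ)..b, κ * f x := (intervalIntegral.integral_const_mul _ _).symm
    _ ≤ _ := intervalIntegral.integral_mono_on hb0 (hint.const_mul κ)
        (hf.intervalIntegrable_mul le_rfl hb0 (by linarith) hlm fun x hx => by
          have := graph_extremeLam_mem_region (h2.trans hb.le) hcd hx.1
            (by linarith [hx.2] : x < 1)
          exact ⟨likelihood_nonneg hn this, likelihood_le_one hn this⟩)
        fun x hx => mul_le_mul_of_nonneg_right (hle x hx)
          (hf.nonneg x ⟨hx.1, by linarith [hx.2]⟩)

theorem posteriorConfidence_extremePrior (hf : IsDensity f) {n : ℕ} (hn : 1 ≤ n) {b : ℝ}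
    (hb : b < 1 / 2) {c d : ℝ × ℝ} (hc0 : 0 ≤ c.1) (hc1 : c.1 ≤ c.2) (hc2 : c.2 ≤ b)
    (hd0 : b ≤ d.1) (hd1 : d.1 ≤ d.2) (hd2 : d.2 ≤ 1)
    (hpos : 0 < ∫ x in (0 : ℝ)..b, f x) :
    posteriorConfidence b n (extremePrior f c d) = 1 / (1 + Q f b n c d) := by
  have hb0 : 0 ≤ b := hc0.trans (hc1.trans hc2)
  have hQ := Qden_pos hf hn hb hc0 hc1 hc2 hpos
  rw [posteriorConfidence, integral_likelihood_eq_add hf hn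
    (extremePrior_isPrior hf (by linarith) (hc2.trans hd0)) (extremePrior_PK1 hf c d),
    setIntegral_extremePrior_left hf hn hb hc0 hc1 hc2 hd0,
    setIntegral_extremePrior_right hf hn hb0 hd0 hd1 hd2 hc2, Q]
  rw [one_add_div hQ.ne', one_div_div]

/-! ### Bounds for an arbitrary feasible prior -/

theorem Qden_le_setIntegral (hf : IsDensity f) {n : ℕ} (hn : 1 ≤ n) {b φ : ℝ} (hb0 : 0 ≤ b)
    (hb : b < 1 / 2) (hφ : 0 ≤ φ) (hφ' : φ ≤ ∫ x in (0 : ℝ)..b, f x) {c : ℝ × ℝ}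
    (hc : IsLowerCut f b φ n c) {F : Measure (ℝ × ℝ)} (hF : IsPrior F) (h1 : PK1 f F)
    (h2 : PK2 φ F) :
    Qden f b n c ≤ ∫ p in {p : ℝ × ℝ | p.1 ∈ Icc 0 b}, likelihood p.1 p.2 n ∂F := by
  have := hF.1
  have hmap := map_fst_eq_densityMeasure hf hF h1
  have hsub : Icc 0 b ⊆ Icc (0 : ℝ) (1 / 2) := Icc_subset_Icc le_rfl hb.le
  let M : Set (ℝ × ℝ) := {p | p.1 ∈ Icc 0 b}
  let S : Set (ℝ × ℝ) := {p | p.2 < p.1}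
  have hM : MeasurableSet M := measurableSet_fst_mem_Icc 0 b
  have hS : MeasurableSet S := measurableSet_lt measurable_snd measurable_fst
  have hq : StrictQuasiconcave (gl n) 0 b ∨ ∀ x ∈ Icc 0 b, gl n x = 0 := by
    rcases hn.eq_or_lt with rfl | hn
    · refine Or.inr fun x hx => ?_
      rw [gl_eq (hsub hx), likelihood_eq _ _ _ le_rfl, likelihood_eq _ _ _ le_rfl]
      simp
    · exact Or.inl (strictQuasiconcave_gl hn hb)
  have key := IsCut.setIntegral_le hf le_rfl hb0 (by linarith) (measurable_gl hn)
    ((continuousOn_gl hn).mono hsub) ((gl_mapsTo hn).mono_left hsub) hq hφ hφ'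
    (isLowerCut_iff.mp hc) hmap (hM.inter hS) inter_subset_left
    ((measureReal_mono inter_subset_right).trans h2.le)
  rw [Qden_eq hf hn hb hc.1.1 hc.1.2.1 hc.1.2.2.2.1,
    ← setIntegral_fst hmap hf le_rfl hb0 (by linarith) (h := fun x => (1 - x) ^ n) (by fun_prop)]
  have hbd : ∀ h : ℝ → ℝ, Measurable h → MapsTo h (Icc 0 b) (Icc 0 1) →
      IntegrableOn (fun p : ℝ × ℝ => h p.1) M F := fun h hm hh => by
    refine Integrable.of_bound (hm.comp measurable_fst).aestronglyMeasurable 1 ?_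
    refine (ae_restrict_iff' hM).mpr (Filter.Eventually.of_forall fun q hq' => ?_)
    rw [Real.norm_eq_abs, abs_of_nonneg (hh hq').1]
    exact (hh hq').2
  have i1 := hbd (fun x => (1 - x) ^ n) (by fun_prop)
    ((pow_one_sub_mapsTo n).mono_left (Icc_subset_Icc le_rfl (by linarith)))
  have i2 := (hbd (gl n) (measurable_gl hn) ((gl_mapsTo hn).mono_left hsub)).indicator hS
  refine (sub_le_sub_left key _).trans ?_
  rw [← setIntegral_indicator hS, ← integral_sub i1 i2]
  refine setIntegral_mono_on_ae (i1.sub i2) (integrable_likelihood hn hF).integrableOn hM ?_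
  filter_upwards [measure_eq_zero_iff_ae_notMem.mp hF.2] with p hp hpM
  rw [notMem_compl_iff] at hp
  by_cases hpS : p ∈ S
  · rw [indicator_of_mem hpS, gl_eq (hsub hpM), likelihood_self _ hn, sub_sub_cancel]
    exact likelihood_le_of_le hn (zero_mem_region hpM.1 (hsub hpM).2)
      ((le_max_left _ _).trans hp.2.2.1)
  · rw [indicator_of_notMem hpS, sub_zero, ← likelihood_self _ hn]
    exact likelihood_le_of_le hn (self_mem_region hp.1 hp.2.1) (not_lt.mp hpS)

theorem setIntegral_le_Qnum (hf : IsDensity f) {n : ℕ} (hn : 1 ≤ n) {b φ : ℝ} (hb0 : 0 ≤ b)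
    (hb : b ≤ 1) (hφ : 0 ≤ φ) (hφ' : φ ≤ ∫ x in b..1, f x) {d : ℝ × ℝ}
    (hd : IsUpperCut f b φ n d) {F : Measure (ℝ × ℝ)} (hF : IsPrior F) (h1 : PK1 f F)
    (h3 : PK3 φ F) :
    ∫ p in {p : ℝ × ℝ | p.1 ∈ Icc b 1}, likelihood p.1 p.2 n ∂F ≤ Qnum f b n d := by
  have := hF.1
  have hmap := map_fst_eq_densityMeasure hf hF h1
  have hsub : Icc b 1 ⊆ Icc (0 : ℝ) 1 := Icc_subset_Icc hb0 le_rfl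
  let M : Set (ℝ × ℝ) := {p | p.1 ∈ Icc b 1}
  let S : Set (ℝ × ℝ) := {p | p.1 < p.2}
  have hM : MeasurableSet M := measurableSet_fst_mem_Icc b 1
  have hS : MeasurableSet S := measurableSet_lt measurable_fst measurable_snd
  have hq : StrictQuasiconcave (gu n) b 1 ∨ ∀ x ∈ Icc b 1, gu n x = 0 := by
    rcases hn.eq_or_lt with rfl | hn
    · refine Or.inr fun x hx => ?_
      rw [gu_eq_sub_pow le_rfl (hsub hx), pow_one, sub_self]
    · exact Or.inl fun x y z hx => strictQuasiconcave_gu hn x y z (hb0.trans hx)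
  have key := IsCut.setIntegral_le hf hb0 hb le_rfl (measurable_gu hn)
    ((continuousOn_gu hn).mono hsub) ((gu_mapsTo hn).mono_left hsub) hq hφ hφ'
    (isUpperCut_iff.mp hd) hmap (hM.inter hS) inter_subset_left
    ((measureReal_mono inter_subset_right).trans h3.le)
  rw [Qnum_eq hf hn hb0 hd.1.1 hd.1.2.1 hd.1.2.2.2.1,
    ← setIntegral_fst hmap hf hb0 hb le_rfl (h := fun x => (1 - x) ^ n) (by fun_prop)]
  have hbd : ∀ h : ℝ → ℝ, Measurable h → MapsTo h (Icc b 1) (Icc 0 1) →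
      IntegrableOn (fun p : ℝ × ℝ => h p.1) M F := fun h hm hh => by
    refine Integrable.of_bound (hm.comp measurable_fst).aestronglyMeasurable 1 ?_
    refine (ae_restrict_iff' hM).mpr (Filter.Eventually.of_forall fun q hq' => ?_)
    rw [Real.norm_eq_abs, abs_of_nonneg (hh hq').1]
    exact (hh hq').2
  have i1 := hbd (fun x => (1 - x) ^ n) (by fun_prop) ((pow_one_sub_mapsTo n).mono_left hsub)
  have i2 := (hbd (gu n) (measurable_gu hn) ((gu_mapsTo hn).mono_left hsub)).indicator hS
  refine le_trans ?_ (add_le_add_right key _)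
  rw [← setIntegral_indicator hS, ← integral_add i1 i2]
  refine setIntegral_mono_on_ae (integrable_likelihood hn hF).integrableOn (i1.add i2) hM ?_
  filter_upwards [measure_eq_zero_iff_ae_notMem.mp hF.2] with p hp hpM
  rw [notMem_compl_iff] at hp
  by_cases hpS : p ∈ S
  · rw [indicator_of_mem hpS, gu_eq (hsub hpM), likelihood_self _ hn, add_sub_cancel]
    exact likelihood_le_of_le hn hp hp.2.2.2
  · rw [indicator_of_notMem hpS, add_zero, ← likelihood_self _ hn]
    exact likelihood_le_of_le hn hp (not_lt.mp hpS)

theorem le_posteriorConfidence (hf : IsDensity f) {n : ℕ} (hn : 1 ≤ n) {b φ₁ φ₂ : ℝ}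
    (hb : b < 1 / 2) (hφ₁ : 0 ≤ φ₁) (hφ₂ : 0 ≤ φ₂) (h1 : φ₁ ≤ ∫ x in (0 : ℝ)..b, f x)
    (h2 : φ₂ ≤ ∫ x in b..1, f x) (hpos : 0 < ∫ x in (0 : ℝ)..b, f x) {c d : ℝ × ℝ}
    (hc : IsLowerCut f b φ₁ n c) (hd : IsUpperCut f b φ₂ n d) {F : Measure (ℝ × ℝ)}
    (hF : F ∈ feasiblePriors f b φ₁ φ₂) :
    1 / (1 + Q f b n c d) ≤ posteriorConfidence b n F := by
  obtain ⟨hprior, hPK1, hPK2, hPK3, -⟩ := hF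
  have hb0 : 0 ≤ b := hc.1.1.trans (hc.1.2.1.trans hc.1.2.2.2.1)
  have hQ := Qden_pos hf hn hb hc.1.1 hc.1.2.1 hc.1.2.2.2.1 hpos
  have hA := Qden_le_setIntegral hf hn hb0 hb hφ₁ h1 hc hprior hPK1 hPK2
  have hB := setIntegral_le_Qnum hf hn hb0 (by linarith) hφ₂ h2 hd hprior hPK1 hPK3
  have hB0 : 0 ≤ ∫ p in {p : ℝ × ℝ | p.1 ∈ Icc b 1}, likelihood p.1 p.2 n ∂F := by
    refine integral_nonneg_of_ae (ae_restrict_of_ae ?_)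
    filter_upwards [measure_eq_zero_iff_ae_notMem.mp hprior.2] with p hp
    rw [notMem_compl_iff] at hp
    exact likelihood_nonneg hn hp
  rw [posteriorConfidence, integral_likelihood_eq_add hf hn hprior hPK1, Q,
    one_add_div hQ.ne', one_div_div, div_le_div_iff₀ (by linarith) (by linarith)]
  nlinarith [mul_le_mul hA hB hB0 (hQ.le.trans hA)]

end

end Klotz

theorem mainTheorem1 (n : ℕ) (hn : 1 ≤ n) (b φ₁ φ₂ : ℝ) (hb0 : 0 < b) (hb : b < 1 / 2)
    (f : ℝ → ℝ)
    -- `f` is a probability density on `[0, 1]`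
    (hf_int : IntervalIntegrable f MeasureTheory.volume 0 1)
    (hf_nonneg : ∀ x ∈ Set.Icc (0 : ℝ) 1, 0 ≤ f x)
    (hf_one : ∫ x in (0 : ℝ)..1, f x = 1)
    (hφ₁ : 0 ≤ φ₁) (hφ₂ : 0 ≤ φ₂)
    -- the fourth constraint can be met by a prior with marginal density `f`
    (hPK4 : φ₁ ≤ ∫ x in (0 : ℝ)..b, f x) (hPK4' : ∫ x in (0 : ℝ)..b, f x ≤ 1 - φ₂)
    -- `P(X ≤ b) ≠ 0`, so that the denominator of `Q` does not vanish
    (hpos : 0 < ∫ x in (0 : ℝ)..b, f x) :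
    Set.MapsTo (Klotz.gl n) (Set.Icc 0 (1 / 2)) (Set.Icc 0 1) ∧
    Set.MapsTo (Klotz.gu n) (Set.Icc 0 1) (Set.Icc 0 1) ∧
    -- the cut-points exist
    (∃ c, Klotz.IsLowerCut f b φ₁ n c) ∧ (∃ d, Klotz.IsUpperCut f b φ₂ n d) ∧
    -- they are unique if `f` charges every interval, the doubts are nontrivial and `n ≥ 2`
    (2 ≤ n → (∀ u v : ℝ, 0 ≤ u → u < v → v ≤ 1 → 0 < ∫ x in u..v, f x) →
      (0 < φ₁ → ∃! c, Klotz.IsLowerCut f b φ₁ n c) ∧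
      (0 < φ₂ → ∃! d, Klotz.IsUpperCut f b φ₂ n d)) ∧
    -- the infimum and the prior that attains it
    (∀ c d : ℝ × ℝ, Klotz.IsLowerCut f b φ₁ n c → Klotz.IsUpperCut f b φ₂ n d →
      0 < Klotz.Qden f b n c ∧
      IsLeast (Klotz.posteriorConfidence b n '' Klotz.feasiblePriors f b φ₁ φ₂)
        (1 / (1 + Klotz.Q f b n c d)) ∧
      Klotz.extremePrior f c d ∈ Klotz.feasiblePriors f b φ₁ φ₂ ∧
      Klotz.posteriorConfidence b n (Klotz.extremePrior f c d) = 1 / (1 + Klotz.Q f b n c d) ∧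
      (Klotz.extremePrior f c d).real {p | p.1 ∈ Set.Ioo c.1 c.2 ∧ p.2 = 0} = φ₁ ∧
      (Klotz.extremePrior f c d).real {p | p.1 ∈ Set.Ioo d.1 d.2 ∧ p.2 = 1} = φ₂) := by
  have hf : Klotz.IsDensity f := ⟨hf_int, hf_nonneg, hf_one⟩
  have hfl : IntervalIntegrable f MeasureTheory.volume 0 b :=
    Klotz.intervalIntegrable_of_subinterval hf_int le_rfl hb0.le (by linarith)
  have hfu : IntervalIntegrable f MeasureTheory.volume b 1 :=
    Klotz.intervalIntegrable_of_subinterval hf_int hb0.le (by linarith) le_rfl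
  have hφu : φ₂ ≤ ∫ x in b..1, f x := by
    have := intervalIntegral.integral_add_adjacent_intervals hfl hfu
    linarith
  have hsubl : Set.Icc 0 b ⊆ Set.Icc (0 : ℝ) (1 / 2) := Set.Icc_subset_Icc le_rfl hb.le
  have hsubu : Set.Icc b 1 ⊆ Set.Icc (0 : ℝ) 1 := Set.Icc_subset_Icc hb0.le le_rfl
  have hendl : ∀ x ∈ Set.Icc 0 b, Klotz.gl n 0 ≤ Klotz.gl n x := fun x hx => by
    rw [Klotz.gl_zero]
    exact (Klotz.gl_mapsTo hn (hsubl hx)).1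
  have hendu : ∀ x ∈ Set.Icc b 1, Klotz.gu n 1 ≤ Klotz.gu n x := fun x hx => by
    rw [Klotz.gu_apply_one hn]
    exact (Klotz.gu_mapsTo hn (hsubu hx)).1
  have hcl := (Klotz.continuousOn_gl hn).mono hsubl
  have hcu := (Klotz.continuousOn_gu hn).mono hsubu
  refine ⟨Klotz.gl_mapsTo hn, Klotz.gu_mapsTo hn,
    Klotz.exists_isCut hb0.le hfl hcl (Or.inl hendl) hφ₁ hPK4,
    Klotz.exists_isCut (by linarith) hfu hcu (Or.inr hendu) hφ₂ hφu, ?_, ?_⟩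
  · intro hn2 hcharge
    refine ⟨fun hp => ?_, fun hp => ?_⟩
    · exact Klotz.existsUnique_isCut hb0.le hfl hcl (Klotz.strictQuasiconcave_gl hn2 hb)
        (Or.inl hendl) (fun u v hu huv hv => hcharge u v hu huv (by linarith)) hp hPK4
    · exact Klotz.existsUnique_isCut (by linarith) hfu hcu
        (fun x y z hx => Klotz.strictQuasiconcave_gu hn2 x y z (hb0.le.trans hx))
        (Or.inr hendu) (fun u v hu huv hv => hcharge u v (by linarith) huv hv) hp hφu
  · intro c d hc hd
    obtain ⟨hc0, hc1, -, hc2, -, -, hcm⟩ := hc.1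
    obtain ⟨hd0, hd1, -, hd2, -, -, hdm⟩ := hd.1
    have hfeas := Klotz.extremePrior_mem_feasiblePriors hf hb0.le hb.le hc0 hc1 hc2 hd0 hd1 hd2
      hcm hdm hPK4 hPK4'
    have hval := Klotz.posteriorConfidence_extremePrior hf hn hb hc0 hc1 hc2 hd0 hd1 hd2 hpos
    refine ⟨Klotz.Qden_pos hf hn hb hc0 hc1 hc2 hpos, ⟨⟨_, hfeas, hval⟩, ?_⟩, hfeas, hval, ?_, ?_⟩
    · rintro _ ⟨F, hF, rfl⟩
      exact Klotz.le_posteriorConfidence hf hn hb hφ₁ hφ₂ hPK4 hφu hpos hc hd hF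
    · have hS : MeasurableSet {p : ℝ × ℝ | p.1 ∈ Set.Ioo c.1 c.2 ∧ p.2 = 0} :=
        (measurable_fst measurableSet_Ioo).inter (measurable_snd (measurableSet_singleton 0))
      rw [Klotz.extremePrior_real c d hS, ← hcm,
        ← hf.real_Ioo hc0 hc1 (by linarith)]
      congr 1
      ext x
      exact ⟨fun h => h.1, fun h => ⟨h, Klotz.extremeLam_of_mem_left h⟩⟩
    · have hS : MeasurableSet {p : ℝ × ℝ | p.1 ∈ Set.Ioo d.1 d.2 ∧ p.2 = 1} :=
        (measurable_fst measurableSet_Ioo).inter (measurable_snd (measurableSet_singleton 1))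
      rw [Klotz.extremePrior_real c d hS, ← hdm,
        ← hf.real_Ioo (by linarith) hd1 hd2]
      congr 1
      ext x
      exact ⟨fun h => h.1, fun h => ⟨h, Klotz.extremeLam_of_mem_right (hc2.trans hd0) h⟩⟩
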